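/- For $\nu\ge 0$ let $\mathcal N_{\mathbb C}(0,\nu)$ be the circularly symmetric complex Gaussian law (real and imaginary parts independent, centred, of variance $\nu/2$). Let $J$ be the $n\times n$ all-ones matrix, and for $W\in\mathbb C^{n\times n}$ and $z\in\mathbb C$ put $$G_W(z)=\frac{1}{n!}\operatorname{per}(J+zW),\qquad D_1(W)=(\log G_W)'(0),\qquad D_2(W)=(\log G_W)''(0),$$ $$X^{(2)}_W(z)=\exp\Bigl(-zD_1(W)-\tfrac{z^2}{2}D_2(W)\Bigr)\,G_W(z),$$ where $\log$ is the principal branch (note that $G_W(0)=1$). **Theorem.** There exist absolute constants $c,C>0$ such that for every $n\ge 1$, $\nu\ge 0$, $z\in\mathbb C$ with $\alpha:=\nu|z|^2/n\le c$, and every random $n\times n$ matrix $W$ with i.i.d. $\mathcal N_{\mathbb C}(0,\nu)$ entries, the expectation $\mathbb E|X^{(2)}_W(z)|^2$ is finite and positive, and $$\log \mathbb E\bigl|X^{(2)}_W(z)\bigr|^2\le C\,\frac{\nu^3|z|^6}{n^2}.$$ -/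

import Mathlib

open MeasureTheory ProbabilityTheory
open scoped NNReal Nat

noncomputable section

/-- The circularly symmetric complex Gaussian law `N_ℂ(0, ν)`: the real and imaginary parts are
independent centred real Gaussians of variance `ν / 2`, so that `𝔼|w|² = ν`. -/
def complexGaussian (ν : ℝ≥0) : Measure ℂ :=
  ((gaussianReal 0 (ν / 2)).prod (gaussianReal 0 (ν / 2))).map fun p : ℝ × ℝ => (⟨p.1, p.2⟩ : ℂ)

/-- `W` is a random `n × n` matrix with i.i.d. `N_ℂ(0, ν)` entries. -/
structure IsComplexGaussianMatrix {Ω : Type*} [MeasurableSpace Ω] (P : Measure Ω) {n : ℕ}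
    (ν : ℝ≥0) (W : Ω → Matrix (Fin n) (Fin n) ℂ) : Prop where
  hasLaw : ∀ i j, HasLaw (fun ω => W ω i j) (complexGaussian ν) P
  indep : iIndepFun (fun (p : Fin n × Fin n) ω => W ω p.1 p.2) P

/-- The normalised shifted permanent `G_W(z) = per(J + z W) / n!`, with `J` the all-ones matrix. -/
def normalizedPermanent {n : ℕ} (W : Matrix (Fin n) (Fin n) ℂ) (z : ℂ) : ℂ :=
  (Matrix.of (fun _ _ => (1 : ℂ)) + z • W).permanent / (n ! : ℂ)

/-- `D_k(W)`, the `k`-th derivative at `z = 0` of `log G_W(z)`. As `G_W(0) = 1`, the principal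
branch of the logarithm is analytic along `G_W` near `z = 0`. -/
def logPermanentDeriv {n : ℕ} (k : ℕ) (W : Matrix (Fin n) (Fin n) ℂ) : ℂ :=
  iteratedDeriv k (fun z : ℂ => Complex.log (normalizedPermanent W z)) 0

/-- The second-order reweighted permanent
`X_W^{(2)}(z) = exp(-z D₁(W) - z² D₂(W) / 2) · per(J + z W) / n!`. -/
def reweightedPermanent {n : ℕ} (W : Matrix (Fin n) (Fin n) ℂ) (z : ℂ) : ℂ :=
  Complex.exp (-z * logPermanentDeriv 1 W - z ^ 2 / 2 * logPermanentDeriv 2 W)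
    * normalizedPermanent W z

end

/-! Write a = ν|z|²/n, so that the claimed bound is of order n a³. The numbers D₁ and D₂ are
explicit linear and quadratic polynomials in the entries of W. Conjugating zW by a real orthogonal
matrix O with constant first row diagonalises them: for B = O(zW)Oᵀ the reweighting exponent is -B₀₀
plus a diagonal quadratic form (`exponent_eq`). The real coordinates of B are i.i.d. Gaussian, so
the squared modulus of the reweighting factor is a product of one-variable weights exp(lx² + bx).
Reweighting by it leaves a product of Gaussians with explicit mass, means and variances.

Under this tilted law |per(J + zW)|² is a double sum over permutations σ, τ of products of n affine
forms and n conjugate ones. Along a permutation, rows and columns are distinct, so all factors have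
the same mean μ and any two in one family have the same pseudo-covariance -ε. Wick's recursion then
has a closed solution (`wick_eq_sum_fullContraction`): choose the holomorphic factors contracted
with conjugate ones; the uncontracted factors of each family contribute a Hermite number, which is
at most μ^l exp(-ε l(l-1)/2). Mixed covariances are concentrated where σ i = τ i, up to an excess of
total size O(n a³). Averaging over σ, τ thus reduces to the generating function of fixed points, at
most exp t with t ≈ n(a + 2a²).

For n ≥ 2 the exponents are, to second order: n(a + a²) from the linear tilt, na² from the Gaussian
normalisations, -n(2a + 3a²) from μ^(2n), -na² from the Hermite correction, and n(a + 2a²) from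
coincidences of σ and τ. Orders a and a² cancel, leaving O(n a³) (`second_moment_estimate`). The
case n = 1 balances differently and is treated apart. Positivity holds because the normalised
permanent has mean 1 and so cannot vanish almost surely. -/

/-! ### Hermite numbers -/

/-- The probabilists' Hermite numbers `𝔼 (μ + i √ε g) ^ l`, by their three-term recurrence. -/
def hermiteMoment (μ ε : ℝ) : ℕ → ℝ
  | 0 => 1
  | 1 => μ
  | l + 2 => μ * hermiteMoment μ ε (l + 1) - ε * (l + 1) * hermiteMoment μ ε l

theorem hermiteMoment_succ (μ ε : ℝ) (l : ℕ) :
    hermiteMoment μ ε (l + 1)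
      = μ * hermiteMoment μ ε l - ε * l * hermiteMoment μ ε (l - 1) := by
  cases l with
  | zero => simp [hermiteMoment]
  | succ l => simp [hermiteMoment]

/-- Positivity and the ratio bound support each other: if the ratio at l is at least μ/2, the
subtracted term ε(l+1)h_l is at most (μ²/4)h_l ≤ (μ/2)h_{l+1}, which keeps the next ratio above μ/2.
-/
theorem hermiteMoment_pos_and_ratio {μ ε : ℝ} {N : ℕ} (hμ : 0 < μ) (hε : 0 ≤ ε)
    (hN : 4 * ε * N ≤ μ ^ 2) (l : ℕ) (hl : l ≤ N) :
    0 < hermiteMoment μ ε l ∧ μ / 2 * hermiteMoment μ ε l ≤ hermiteMoment μ ε (l + 1) := by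
  induction l with
  | zero => simp [hermiteMoment]; linarith
  | succ l ih =>
    obtain ⟨h1, h2⟩ := ih (by omega)
    have hpos : 0 < hermiteMoment μ ε (l + 1) := lt_of_lt_of_le (by positivity) h2
    refine ⟨hpos, ?_⟩
    rw [hermiteMoment_succ μ ε (l + 1), Nat.add_sub_cancel]
    have hl' : ((l + 1 : ℕ) : ℝ) ≤ N := by exact_mod_cast hl
    have h3 : 4 * (ε * (l + 1 : ℕ)) ≤ μ ^ 2 := by nlinarith
    have h4 : ε * (l + 1 : ℕ) * hermiteMoment μ ε l ≤ μ / 2 * hermiteMoment μ ε (l + 1) := by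
      have h5 : ε * (l + 1 : ℕ) * hermiteMoment μ ε l ≤ μ ^ 2 / 4 * hermiteMoment μ ε l :=
        mul_le_mul_of_nonneg_right (by linarith) h1.le
      nlinarith
    linarith

/-- Positivity gives h_l ≤ μ h_{l-1}; as μ ≤ 1, this makes the subtracted term at least εl·μh_l.
Each step therefore multiplies by at most μ(1 - εl) ≤ μ exp(-εl), and the exponents add up to
εl(l-1)/2. -/
theorem hermiteMoment_le {μ ε : ℝ} {N : ℕ} (hμ : 0 < μ) (hμ1 : μ ≤ 1) (hε : 0 ≤ ε)
    (hN : 4 * ε * N ≤ μ ^ 2) (l : ℕ) (hl : l ≤ N) :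
    hermiteMoment μ ε l ≤ μ ^ l * Real.exp (-(ε * (l * (l - 1)) / 2)) := by
  have hstep : ∀ l ≤ N, hermiteMoment μ ε (l + 1) ≤ μ * hermiteMoment μ ε l := by
    intro l hl
    rw [hermiteMoment_succ]
    have := (hermiteMoment_pos_and_ratio hμ hε hN (l - 1) (by omega)).1
    have : 0 ≤ ε * l * hermiteMoment μ ε (l - 1) := by positivity
    linarith
  induction l with
  | zero => simp [hermiteMoment]
  | succ l ih =>
    have h0 := (hermiteMoment_pos_and_ratio hμ hε hN l (by omega)).1
    have hkey : hermiteMoment μ ε (l + 1) ≤ μ * (1 - ε * l) * hermiteMoment μ ε l := by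
      rw [hermiteMoment_succ]
      cases l with
      | zero => simp
      | succ l =>
        have h1 := hstep l (by omega)
        have h2 := (hermiteMoment_pos_and_ratio hμ hε hN l (by omega)).1
        simp only [Nat.add_sub_cancel]
        have h3 : μ * hermiteMoment μ ε (l + 1) ≤ hermiteMoment μ ε l := by nlinarith
        have h4 : 0 ≤ ε * (l + 1 : ℕ) := by positivity
        nlinarith
    have hexp : 1 - ε * l ≤ Real.exp (-(ε * l)) := by
      have := Real.add_one_le_exp (-(ε * l)); linarith
    calc hermiteMoment μ ε (l + 1) ≤ μ * (1 - ε * l) * hermiteMoment μ ε l := hkey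
      _ ≤ μ * Real.exp (-(ε * l)) * hermiteMoment μ ε l := by gcongr
      _ ≤ μ * Real.exp (-(ε * l)) * (μ ^ l * Real.exp (-(ε * (l * (l - 1)) / 2))) := by
          gcongr; exact ih (by omega)
      _ = _ := by
          rw [pow_succ, show μ * Real.exp (-(ε * l)) * (μ ^ l * Real.exp (-(ε * (l * (l - 1)) / 2)))
            = μ ^ l * μ * (Real.exp (-(ε * l)) * Real.exp (-(ε * (l * (l - 1)) / 2))) by ring,
            ← Real.exp_add]
          congr 2
          push_cast
          ring

/-! ### Contraction operators on functions of finite sets -/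

section Contraction

variable {ι : Type*} [DecidableEq ι]

/-- Contraction of one factor against the factors indexed by `T`, with weights `κ j`. -/
def contract (κ : ι → ℂ) : Module.End ℂ (Finset ι → ℂ) where
  toFun f T := ∑ j ∈ T, κ j * f (T.erase j)
  map_add' f g := by ext T; simp [mul_add, Finset.sum_add_distrib]
  map_smul' c f := by
    ext T
    simp only [Pi.smul_apply, smul_eq_mul, RingHom.id_apply, Finset.mul_sum]
    exact Finset.sum_congr rfl fun _ _ => by ring

theorem contract_apply (κ : ι → ℂ) (f : Finset ι → ℂ) (T : Finset ι) :
    contract κ f T = ∑ j ∈ T, κ j * f (T.erase j) := rfl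

/-- Removing two distinct partners from T is symmetric in the order of removal. This makes the
product of contractions over a finite set independent of any enumeration, so any element can be
peeled off first. -/
theorem commute_contract (κ κ' : ι → ℂ) : Commute (contract κ) (contract κ') := by
  refine LinearMap.ext fun f => funext fun T => ?_
  simp only [Module.End.mul_apply, contract_apply, Finset.mul_sum]
  rw [Finset.sum_comm' (t' := T) (s' := fun j => T.erase j)]
  · refine Finset.sum_congr rfl fun j _ => Finset.sum_congr rfl fun i _ => ?_
    rw [Finset.erase_right_comm]; ring
  · intro i j
    simp only [Finset.mem_erase]
    tauto

variable (κ : ι → ι → ℂ) (h : ℕ → ℝ)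

theorem pairwise_commute_contract (I : Set ι) :
    I.Pairwise (Function.onFun Commute fun i => contract (κ i)) :=
  fun _ _ _ _ _ => commute_contract _ _

/-- The sum over all ways of contracting every factor of `I` with a distinct factor of `T`, the
remaining `l` factors of `T` contributing `h l`. -/
def fullContraction (I : Finset ι) : Finset ι → ℂ :=
  I.noncommProd (fun i => contract (κ i)) (pairwise_commute_contract κ I)
    (fun T => (h T.card : ℂ))

theorem fullContraction_empty (T : Finset ι) : fullContraction κ h ∅ T = h T.card := by
  rw [fullContraction, Finset.noncommProd_empty]
  rfl

theorem fullContraction_insert {i : ι} {I : Finset ι} (hi : i ∉ I) (T : Finset ι) :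
    fullContraction κ h (insert i I) T = ∑ j ∈ T, κ i j * fullContraction κ h I (T.erase j) := by
  rw [fullContraction, Finset.noncommProd_insert_of_notMem _ _ _ _ hi]
  rfl

/-- Dropping the requirement that the partners be distinct bounds the sum over injective pairings by
a product of full row sums, while the uncontracted factor depends only on the number of elements
left. -/
theorem norm_fullContraction_le [Fintype ι] (hh : ∀ l ≤ Fintype.card ι, 0 ≤ h l)
    (I T : Finset ι) :
    ‖fullContraction κ h I T‖
      ≤ (if I.card ≤ T.card then h (T.card - I.card) else 0) * ∏ i ∈ I, ∑ j, ‖κ i j‖ := by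
  induction I using Finset.induction_on generalizing T with
  | empty =>
    rw [fullContraction_empty]
    simp [abs_of_nonneg (hh _ T.card_le_univ)]
  | insert i I hi ih =>
    rw [fullContraction_insert κ h hi, Finset.card_insert_of_notMem hi, Finset.prod_insert hi]
    have hb : 0 ≤ (if I.card + 1 ≤ T.card then h (T.card - (I.card + 1)) else 0)
        * ∏ i ∈ I, ∑ j, ‖κ i j‖ := by
      refine mul_nonneg ?_ (Finset.prod_nonneg fun _ _ => Finset.sum_nonneg fun _ _ => norm_nonneg _)
      split_ifs
      · exact hh _ (le_trans (Nat.sub_le _ _) T.card_le_univ)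
      · exact le_rfl
    calc ‖∑ j ∈ T, κ i j * fullContraction κ h I (T.erase j)‖
        ≤ ∑ j ∈ T, ‖κ i j‖ * ((if I.card + 1 ≤ T.card then h (T.card - (I.card + 1)) else 0)
            * ∏ i ∈ I, ∑ j, ‖κ i j‖) := by
          refine (norm_sum_le _ _).trans (Finset.sum_le_sum fun j hj => ?_)
          rw [norm_mul]
          refine mul_le_mul_of_nonneg_left ((ih _).trans_eq ?_) (norm_nonneg _)
          have hT : 0 < T.card := Finset.card_pos.2 ⟨j, hj⟩
          rw [Finset.card_erase_of_mem hj, show T.card - 1 - I.card = T.card - (I.card + 1) by omega]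
          congr 1
          exact if_congr (by omega) rfl rfl
      _ ≤ ∑ j, ‖κ i j‖ * ((if I.card + 1 ≤ T.card then h (T.card - (I.card + 1)) else 0)
            * ∏ i ∈ I, ∑ j, ‖κ i j‖) :=
          Finset.sum_le_sum_of_subset_of_nonneg (Finset.subset_univ _)
            fun _ _ _ => mul_nonneg (norm_nonneg _) hb
      _ = _ := by rw [← Finset.sum_mul]; ring

end Contraction

/-! ### Solution of Wick's recursion with constant pseudo-covariance -/

section Wick

variable {ι : Type*} [DecidableEq ι] {w : Finset ι → Finset ι → ℂ} {κ : ι → ι → ℂ} {μ ε : ℝ}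

theorem wick_empty_left (h0 : w ∅ ∅ = 1)
    (hT : ∀ j T, j ∉ T → w ∅ (insert j T) = μ * w ∅ T - ε * ∑ l ∈ T, w ∅ (T.erase l))
    (T : Finset ι) : w ∅ T = hermiteMoment μ ε T.card := by
  induction T using Finset.strongInduction with
  | H T ih =>
    rcases T.eq_empty_or_nonempty with rfl | ⟨j, hj⟩
    · simpa [hermiteMoment] using h0
    · have hcard := Finset.card_erase_of_mem hj
      obtain ⟨c, hc⟩ : ∃ c, T.card = c + 1 :=
        ⟨T.card - 1, (Nat.sub_add_cancel (Finset.card_pos.2 ⟨j, hj⟩)).symm⟩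
      rw [← Finset.insert_erase hj, hT j _ (Finset.notMem_erase j T),
        ih _ (Finset.erase_ssubset hj), Finset.insert_erase hj, hcard, hc, hermiteMoment_succ]
      rw [Finset.sum_congr rfl (g := fun _ => (hermiteMoment μ ε (c - 1) : ℂ)) fun l hl => ?_]
      · rw [Finset.sum_const, hcard, hc]
        simp only [Nat.add_sub_cancel]
        push_cast
        rw [nsmul_eq_mul]
        ring
      · rw [ih _ ((Finset.erase_subset _ _).trans_ssubset (Finset.erase_ssubset hj)),
          Finset.card_erase_of_mem hl, hcard, hc]
        rfl

/-- Here I is the set of holomorphic factors paired with conjugate ones. Splitting according to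
whether the new factor i lies in I turns the recursion for w into the three-term recurrence for S \
I plus the contraction of i. -/
theorem wick_eq_sum_fullContraction (h0 : w ∅ ∅ = 1)
    (hT : ∀ j T, j ∉ T → w ∅ (insert j T) = μ * w ∅ T - ε * ∑ l ∈ T, w ∅ (T.erase l))
    (hS : ∀ i S T, i ∉ S → w (insert i S) T = μ * w S T - ε * ∑ l ∈ S, w (S.erase l) T
      + ∑ j ∈ T, κ i j * w S (T.erase j))
    (S T : Finset ι) :
    w S T = ∑ I ∈ S.powerset, (hermiteMoment μ ε (S \ I).card : ℂ)
      * fullContraction κ (hermiteMoment μ ε) I T := by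
  induction S using Finset.strongInduction generalizing T with
  | H S ih =>
    rcases S.eq_empty_or_nonempty with rfl | ⟨i, hi⟩
    · simp [fullContraction_empty, wick_empty_left h0 hT T, hermiteMoment]
    · obtain ⟨S', hiS, rfl⟩ : ∃ S', i ∉ S' ∧ S = insert i S' :=
        ⟨S.erase i, Finset.notMem_erase _ _, (Finset.insert_erase hi).symm⟩
      have hlt : S' ⊂ insert i S' := Finset.ssubset_insert hiS
      rw [hS i S' T hiS, Finset.sum_powerset_insert hiS, ih S' hlt T]
      -- Removing l and then choosing I inside the rest is the same as choosing I and then l in S' \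
      -- I; the summand no longer depends on l, whence the factor |S' \ I|.
      have e1 : ∑ l ∈ S', w (S'.erase l) T = ∑ I ∈ S'.powerset, ((S' \ I).card : ℂ)
          * (hermiteMoment μ ε ((S' \ I).card - 1) * fullContraction κ (hermiteMoment μ ε) I T) := by
        rw [Finset.sum_congr rfl fun l hl =>
          ih (S'.erase l) ((Finset.erase_subset _ _).trans_ssubset hlt) T]
        rw [Finset.sum_comm' (t' := S'.powerset) (s' := fun I => S' \ I)]
        · refine Finset.sum_congr rfl fun I _ => ?_
          rw [← nsmul_eq_mul, ← Finset.sum_const]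
          refine Finset.sum_congr rfl fun l hl => ?_
          rw [Finset.erase_sdiff_comm, Finset.card_erase_of_mem hl]
        · intro l I
          simp only [Finset.mem_powerset, Finset.mem_sdiff, Finset.subset_erase]
          tauto
      have e2 : ∑ j ∈ T, κ i j * w S' (T.erase j) = ∑ I ∈ S'.powerset,
          (hermiteMoment μ ε (insert i S' \ insert i I).card : ℂ)
            * fullContraction κ (hermiteMoment μ ε) (insert i I) T := by
        simp_rw [ih S' hlt, Finset.mul_sum]
        rw [Finset.sum_comm]
        refine Finset.sum_congr rfl fun I hI => ?_
        have hiI : i ∉ I := fun h => hiS (Finset.mem_powerset.1 hI h)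
        rw [fullContraction_insert _ _ hiI, Finset.insert_sdiff_insert,
          Finset.sdiff_insert_of_notMem hiS, Finset.mul_sum]
        exact Finset.sum_congr rfl fun _ _ => by ring
      rw [e1, e2, Finset.mul_sum, Finset.mul_sum, ← Finset.sum_sub_distrib]
      congr 1
      refine Finset.sum_congr rfl fun I hI => ?_
      have hiI : i ∉ I := fun h => hiS (Finset.mem_powerset.1 hI h)
      rw [Finset.insert_sdiff_of_notMem _ hiI,
        Finset.card_insert_of_notMem (fun h => hiS (Finset.mem_sdiff.1 h).1), hermiteMoment_succ]
      push_cast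
      ring

/-- A mixed contraction removes one factor from each family, and each removal costs at most q =
exp(εn)/μ relative to the uncontracted value. Hence each contracted i carries q² times its row sum
of |κ|, and the sum over I is an expanded product. -/
theorem norm_wick_univ_le [Fintype ι] (h0 : w ∅ ∅ = 1)
    (hT : ∀ j T, j ∉ T → w ∅ (insert j T) = μ * w ∅ T - ε * ∑ l ∈ T, w ∅ (T.erase l))
    (hS : ∀ i S T, i ∉ S → w (insert i S) T = μ * w S T - ε * ∑ l ∈ S, w (S.erase l) T
      + ∑ j ∈ T, κ i j * w S (T.erase j))
    (hμ : 0 < μ) (hμ1 : μ ≤ 1) (hε : 0 ≤ ε) {n : ℕ} (hn : Fintype.card ι = n)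
    (hN : 4 * ε * n ≤ μ ^ 2) :
    ‖w Finset.univ Finset.univ‖ ≤ (μ ^ n * Real.exp (-(ε * (n * (n - 1)) / 2))) ^ 2
      * ∏ i, (1 + (Real.exp (ε * n) / μ) ^ 2 * ∑ j, ‖κ i j‖) := by
  subst hn
  set n := Fintype.card ι
  set H := μ ^ n * Real.exp (-(ε * (n * (n - 1)) / 2))
  set q := Real.exp (ε * n) / μ
  have hpos : ∀ l ≤ n, 0 ≤ hermiteMoment μ ε l := fun l hl =>
    (hermiteMoment_pos_and_ratio hμ hε hN l hl).1.le
  -- Uses n(n-1) - (n-j)(n-j-1) = 2nj - j² - j ≤ 2nj.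
  have hH : ∀ j ≤ n, hermiteMoment μ ε (n - j) ≤ H * q ^ j := by
    intro j hj
    refine (hermiteMoment_le hμ hμ1 hε hN _ (Nat.sub_le _ _)).trans ?_
    have e : H * q ^ j = μ ^ (n - j)
        * Real.exp (-(ε * (n * (n - 1)) / 2) + j * (ε * n)) := by
      have : μ ^ n = μ ^ (n - j) * μ ^ j := by rw [← pow_add, Nat.sub_add_cancel hj]
      simp only [H, q, div_pow, this, Real.exp_add, ← Real.exp_nat_mul]
      field_simp
    rw [e]
    refine mul_le_mul_of_nonneg_left (Real.exp_le_exp.2 ?_) (by positivity)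
    rw [Nat.cast_sub hj]
    have hjj : (0 : ℝ) ≤ j := Nat.cast_nonneg j
    nlinarith [mul_nonneg hε (mul_nonneg hjj hjj), mul_nonneg hε hjj]
  rw [wick_eq_sum_fullContraction h0 hT hS, Finset.powerset_univ]
  rw [Finset.prod_one_add, Finset.powerset_univ, Finset.mul_sum]
  refine (norm_sum_le _ _).trans (Finset.sum_le_sum fun I _ => ?_)
  have hIc : I.card ≤ n := I.card_le_univ
  have hP : 0 ≤ ∏ i ∈ I, ∑ j, ‖κ i j‖ :=
    Finset.prod_nonneg fun _ _ => Finset.sum_nonneg fun _ _ => norm_nonneg _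
  have hu := norm_fullContraction_le κ (hermiteMoment μ ε) hpos I Finset.univ
  rw [Finset.card_univ, if_pos hIc] at hu
  have hc : (Finset.univ \ I).card = n - I.card := by
    rw [Finset.card_sdiff_of_subset (Finset.subset_univ _), Finset.card_univ]
  rw [norm_mul, hc, Complex.norm_real, Real.norm_of_nonneg (hpos _ (Nat.sub_le _ _)),
    Finset.prod_mul_distrib, Finset.prod_const]
  have h1 := hH _ hIc
  have h2 := hpos (n - I.card) (Nat.sub_le _ _)
  calc _ ≤ hermiteMoment μ ε (n - I.card) * (hermiteMoment μ ε (n - I.card)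
        * ∏ i ∈ I, ∑ j, ‖κ i j‖) := mul_le_mul_of_nonneg_left hu h2
    _ ≤ (H * q ^ I.card) * ((H * q ^ I.card) * ∏ i ∈ I, ∑ j, ‖κ i j‖) := by gcongr
    _ = _ := by ring

end Wick

/-! ### One-dimensional Gaussians: moments and exponential tilting -/

theorem integrable_pow_gaussianReal (m : ℝ) (v : ℝ≥0) (k : ℕ) :
    Integrable (fun x : ℝ => x ^ k) (gaussianReal m v) := by
  have h : (0 : ℝ) ∈ interior (integrableExpSet id (gaussianReal m v)) := by
    rw [integrableExpSet_id_gaussianReal]; simp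
  simpa using integrable_pow_of_mem_interior_integrableExpSet h k

theorem hasDerivAt_gaussianPDFReal (m : ℝ) {v : ℝ≥0} (hv : v ≠ 0) (x : ℝ) :
    HasDerivAt (gaussianPDFReal m v) (-((x - m) / v) * gaussianPDFReal m v x) x := by
  have hv' : (v : ℝ) ≠ 0 := by exact_mod_cast hv
  have h1 : HasDerivAt (fun x : ℝ => -(x - m) ^ 2 / (2 * v)) (-((x - m) / v)) x := by
    have := ((((hasDerivAt_id x).sub_const m).pow 2).neg).div_const (2 * (v : ℝ))
    refine this.congr_deriv ?_
    simp
    field_simp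
  have := (h1.exp).const_mul ((√(2 * Real.pi * v))⁻¹)
  refine this.congr_deriv ?_
  rw [gaussianPDFReal]
  ring

/-- Gaussian integration by parts for monomials. -/
theorem integral_pow_succ_gaussianReal (m : ℝ) (v : ℝ≥0) (k : ℕ) :
    ∫ x, x ^ (k + 1) ∂gaussianReal m v
      = m * ∫ x, x ^ k ∂gaussianReal m v + v * (k * ∫ x, x ^ (k - 1) ∂gaussianReal m v) := by
  rcases eq_or_ne v 0 with rfl | hv
  · simp [gaussianReal_zero_var, pow_succ']
  have hv' : (v : ℝ) ≠ 0 := by exact_mod_cast hv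
  have hint : ∀ j : ℕ, Integrable (fun x : ℝ => x ^ j * gaussianPDFReal m v x) := by
    intro j
    have := integrable_pow_gaussianReal m v j
    rw [gaussianReal_of_var_ne_zero _ hv,
      integrable_withDensity_iff_integrable_smul' (measurable_gaussianPDF m v)
        (Filter.Eventually.of_forall fun _ => gaussianPDF_lt_top)] at this
    refine this.congr (Filter.Eventually.of_forall fun x => ?_)
    simp [toReal_gaussianPDF, mul_comm]
  have hI : ∀ j : ℕ, ∫ x, x ^ j ∂gaussianReal m v = ∫ x, x ^ j * gaussianPDFReal m v x := by
    intro j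
    rw [integral_gaussianReal_eq_integral_smul hv]
    simp [mul_comm]
  have hd : ∀ x, HasDerivAt (fun x : ℝ => x ^ k * gaussianPDFReal m v x)
      (k * (x ^ (k - 1) * gaussianPDFReal m v x)
        - (v : ℝ)⁻¹ * (x ^ (k + 1) * gaussianPDFReal m v x)
        + (v : ℝ)⁻¹ * m * (x ^ k * gaussianPDFReal m v x)) x := by
    intro x
    refine ((hasDerivAt_pow k x).mul (hasDerivAt_gaussianPDFReal m hv x)).congr_deriv ?_
    rw [pow_succ]
    field_simp
    ring
  have hz := integral_eq_zero_of_hasDerivAt_of_integrable hd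
    ((((hint (k - 1)).const_mul _).sub ((hint (k + 1)).const_mul _)).add
      ((hint k).const_mul _)) (hint k)
  rw [integral_add, integral_sub, integral_const_mul, integral_const_mul, integral_const_mul,
    ← hI, ← hI, ← hI] at hz
  · field_simp at hz
    linarith
  · exact (hint _).const_mul _
  · exact (hint _).const_mul _
  · exact ((hint _).const_mul _).sub ((hint _).const_mul _)
  · exact (hint _).const_mul _

/-- The variance of the Gaussian of variance `s` reweighted by `exp (l x²)`. -/
noncomputable def tiltVar (s : ℝ≥0) (l : ℝ) : ℝ≥0 := Real.toNNReal (s / (1 - 2 * s * l))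

theorem coe_tiltVar {s : ℝ≥0} {l : ℝ} (h : 2 * s * l < 1) :
    (tiltVar s l : ℝ) = s / (1 - 2 * s * l) :=
  Real.coe_toNNReal _ (div_nonneg s.2 (by linarith))

/-- The total mass of `exp (l x² + b x)` under the centred Gaussian of variance `s`. -/
noncomputable def tiltMass (s : ℝ≥0) (l b : ℝ) : ℝ :=
  (√(1 - 2 * s * l))⁻¹ * Real.exp (b ^ 2 * tiltVar s l / 2)

theorem tiltMass_pos {s : ℝ≥0} {l : ℝ} (h : 2 * s * l < 1) (b : ℝ) : 0 < tiltMass s l b := by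
  have : 0 < √(1 - 2 * s * l) := Real.sqrt_pos.2 (by linarith)
  unfold tiltMass
  positivity

/-- Completing the square: a Gaussian reweighted by exp(lx² + bx) is a multiple of another Gaussian.
The condition 2sl < 1 keeps the new quadratic exponent negative, and s = 0 is a point mass at the
origin. -/
theorem gaussianReal_withDensity_exp_quadratic {s : ℝ≥0} {l : ℝ} (h : 2 * s * l < 1) (b : ℝ) :
    (gaussianReal 0 s).withDensity (fun x => ENNReal.ofReal (Real.exp (l * x ^ 2 + b * x)))
      = ENNReal.ofReal (tiltMass s l b) • gaussianReal (b * tiltVar s l) (tiltVar s l) := by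
  have hpos : 0 < 1 - 2 * s * l := by linarith
  rcases eq_or_ne s 0 with rfl | hs
  · have e : tiltVar 0 l = 0 := by simp [tiltVar]
    rw [e, gaussianReal_zero_var]
    simp only [NNReal.coe_zero, mul_zero, gaussianReal_zero_var]
    rw [dirac_withDensity]
    simp [tiltMass, e]
  have hs' : (0 : ℝ) < s := by positivity
  have ht : tiltVar s l ≠ 0 := by
    have : (0 : ℝ) < tiltVar s l := by rw [coe_tiltVar h]; positivity
    exact_mod_cast this.ne'
  rw [gaussianReal_of_var_ne_zero _ hs, gaussianReal_of_var_ne_zero _ ht,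
    ← withDensity_mul _ (measurable_gaussianPDF _ _) (by fun_prop),
    ← withDensity_smul _ (measurable_gaussianPDF _ _)]
  congr 1
  ext x
  simp only [Pi.mul_apply, Pi.smul_apply, smul_eq_mul, gaussianPDF]
  rw [← ENNReal.ofReal_mul (gaussianPDFReal_nonneg _ _ _), ← ENNReal.ofReal_mul (tiltMass_pos h b).le]
  congr 1
  rw [gaussianPDFReal, gaussianPDFReal, tiltMass, coe_tiltVar h]
  have hsq : √(2 * Real.pi * (s / (1 - 2 * s * l)))
      = √(2 * Real.pi * s) / √(1 - 2 * s * l) := by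
    rw [← mul_div_assoc, Real.sqrt_div (by positivity)]
  have h0 : √(1 - 2 * s * l) ≠ 0 := (Real.sqrt_pos.2 hpos).ne'
  have h1 : √(2 * Real.pi * s) ≠ 0 := (Real.sqrt_pos.2 (by positivity)).ne'
  rw [hsq, mul_assoc, ← Real.exp_add, inv_div, show ∀ a b c d e : ℝ,
    a⁻¹ * b * (a / c * d) = (a⁻¹ * a) * (c⁻¹ * (b * d)) from fun _ _ _ _ _ => by ring,
    inv_mul_cancel₀ h0, one_mul, ← Real.exp_add]
  · congr 2
    field_simp
    ring
  · exact 0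

theorem integrable_mul_exp_quadratic_gaussianReal {s : ℝ≥0} {l : ℝ} (h : 2 * s * l < 1) (b : ℝ)
    (k : ℕ) : Integrable (fun x : ℝ => x ^ k * Real.exp (l * x ^ 2 + b * x)) (gaussianReal 0 s) := by
  have h1 := (integrable_pow_gaussianReal (b * tiltVar s l) (tiltVar s l) k).smul_measure
    (ENNReal.ofReal_ne_top (r := tiltMass s l b))
  rw [← gaussianReal_withDensity_exp_quadratic h b,
    integrable_withDensity_iff_integrable_smul' (by fun_prop)
      (Filter.Eventually.of_forall fun _ => ENNReal.ofReal_lt_top)] at h1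
  refine h1.congr (Filter.Eventually.of_forall fun x => ?_)
  simp only [smul_eq_mul]
  rw [ENNReal.toReal_ofReal (Real.exp_pos _).le, mul_comm]

/-- The moments of the centred Gaussian of variance `s` reweighted by `exp (l x² + b x)`. -/
noncomputable def tiltMoment (s : ℝ≥0) (l b : ℝ) (k : ℕ) : ℝ :=
  ∫ x, x ^ k * Real.exp (l * x ^ 2 + b * x) ∂gaussianReal 0 s

theorem tiltMoment_eq {s : ℝ≥0} {l : ℝ} (h : 2 * s * l < 1) (b : ℝ) (k : ℕ) :
    tiltMoment s l b k
      = tiltMass s l b * ∫ x, x ^ k ∂gaussianReal (b * tiltVar s l) (tiltVar s l) := by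
  have h1 : ∫ x, x ^ k ∂((gaussianReal 0 s).withDensity
      (fun x => ENNReal.ofReal (Real.exp (l * x ^ 2 + b * x)))) = tiltMoment s l b k := by
    rw [integral_withDensity_eq_integral_toReal_smul (by fun_prop)
      (Filter.Eventually.of_forall fun _ => ENNReal.ofReal_lt_top), tiltMoment]
    refine integral_congr_ae (Filter.Eventually.of_forall fun x => ?_)
    simp only [smul_eq_mul]
    rw [ENNReal.toReal_ofReal (Real.exp_pos _).le, mul_comm]
  rw [← h1, gaussianReal_withDensity_exp_quadratic h b, integral_smul_measure,
    ENNReal.toReal_ofReal (tiltMass_pos h b).le, smul_eq_mul]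

theorem tiltMoment_zero {s : ℝ≥0} {l : ℝ} (h : 2 * s * l < 1) (b : ℝ) :
    tiltMoment s l b 0 = tiltMass s l b := by
  rw [tiltMoment_eq h]; simp

theorem tiltMoment_succ {s : ℝ≥0} {l : ℝ} (h : 2 * s * l < 1) (b : ℝ) (k : ℕ) :
    tiltMoment s l b (k + 1) = b * tiltVar s l * tiltMoment s l b k
      + tiltVar s l * (k * tiltMoment s l b (k - 1)) := by
  rw [tiltMoment_eq h, tiltMoment_eq h, tiltMoment_eq h, integral_pow_succ_gaussianReal]
  ring

/-! ### Tilted Gaussian expectation of polynomials -/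

section Functional

variable {ι : Type*} [Fintype ι] (s : ℝ≥0) (l b : ι → ℝ)

/-- The weight `∏ exp (l x² + b x)`. -/
noncomputable def tiltWeight (g : ι → ℝ) : ℝ := ∏ p, Real.exp (l p * g p ^ 2 + b p * g p)

/-- Evaluation of a complex polynomial at a real point. -/
noncomputable def evalReal (f : MvPolynomial ι ℂ) (g : ι → ℝ) : ℂ := MvPolynomial.eval (fun p => (g p : ℂ)) f

variable {s l}

theorem tiltWeight_mul_monomial (u : ι →₀ ℕ) (a : ℂ) (g : ι → ℝ) :
    (tiltWeight l b g : ℂ) * evalReal (MvPolynomial.monomial u a) g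
      = a * ∏ p, ((g p ^ u p * Real.exp (l p * g p ^ 2 + b p * g p) : ℝ) : ℂ) := by
  rw [tiltWeight, evalReal, MvPolynomial.eval_monomial, Finsupp.prod_fintype _ _ (by simp)]
  push_cast
  rw [Finset.prod_mul_distrib]
  ring

theorem integrable_tiltWeight_mul (h : ∀ p, 2 * s * l p < 1) (f : MvPolynomial ι ℂ) :
    Integrable (fun g : ι → ℝ => (tiltWeight l b g : ℂ) * evalReal f g)
      (Measure.pi fun _ => gaussianReal 0 s) := by
  induction f using MvPolynomial.induction_on' with
  | monomial u a =>
    simp_rw [tiltWeight_mul_monomial]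
    refine Integrable.const_mul (Integrable.fintype_prod_dep
      (f := fun p (x : ℝ) => ((x ^ u p * Real.exp (l p * x ^ 2 + b p * x) : ℝ) : ℂ)) fun p => ?_) a
    exact (integrable_mul_exp_quadratic_gaussianReal (h p) (b p) (u p)).ofReal
  | add p q hp hq =>
    refine (hp.add hq).congr (Filter.Eventually.of_forall fun g => ?_)
    simp [evalReal, mul_add]

/-- The reweighted Gaussian expectation of a polynomial. -/
noncomputable def tiltExpect (h : ∀ p, 2 * s * l p < 1) : MvPolynomial ι ℂ →ₗ[ℂ] ℂ where
  toFun f := ∫ g, (tiltWeight l b g : ℂ) * evalReal f g ∂(Measure.pi fun _ => gaussianReal 0 s)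
  map_add' f f' := by
    rw [← integral_add (integrable_tiltWeight_mul b h f) (integrable_tiltWeight_mul b h f')]
    simp [evalReal, mul_add]
  map_smul' c f := by
    rw [RingHom.id_apply, smul_eq_mul, ← integral_const_mul]
    refine integral_congr_ae (Filter.Eventually.of_forall fun g => ?_)
    simp only [evalReal, MvPolynomial.smul_eval]
    ring

theorem tiltExpect_apply (h : ∀ p, 2 * s * l p < 1) (f : MvPolynomial ι ℂ) : tiltExpect b h f
    = ∫ g, (tiltWeight l b g : ℂ) * evalReal f g ∂(Measure.pi fun _ => gaussianReal 0 s) := rfl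

theorem tiltExpect_monomial (h : ∀ p, 2 * s * l p < 1) (u : ι →₀ ℕ) (a : ℂ) :
    tiltExpect b h (MvPolynomial.monomial u a)
      = a * ∏ p, (tiltMoment s (l p) (b p) (u p) : ℂ) := by
  rw [tiltExpect_apply]
  simp_rw [tiltWeight_mul_monomial]
  rw [integral_const_mul, integral_fintype_prod_eq_prod
    (f := fun p (x : ℝ) => ((x ^ u p * Real.exp (l p * x ^ 2 + b p * x) : ℝ) : ℂ))]
  congr 1
  refine Finset.prod_congr rfl fun p _ => ?_
  exact integral_ofReal

theorem tiltExpect_one (h : ∀ p, 2 * s * l p < 1) :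
    tiltExpect b h 1 = ((∏ p, tiltMass s (l p) (b p) : ℝ) : ℂ) := by
  rw [← MvPolynomial.C_1, MvPolynomial.C_apply, tiltExpect_monomial]
  simp only [Finsupp.coe_zero, Pi.zero_apply, one_mul]
  push_cast
  exact Finset.prod_congr rfl fun p _ => by rw [tiltMoment_zero (h p)]

/-- An affine form in the coordinates. -/
noncomputable def affineForm (a : ℂ) (c : ι → ℂ) : MvPolynomial ι ℂ :=
  MvPolynomial.C a + ∑ p, MvPolynomial.C (c p) * MvPolynomial.X p

theorem evalReal_affineForm (a : ℂ) (c : ι → ℂ) (g : ι → ℝ) :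
    evalReal (affineForm a c) g = a + ∑ p, c p * g p := by
  simp [evalReal, affineForm]

variable [DecidableEq ι]

/-- Gaussian integration by parts in the coordinate p. On monomials the expectation factorises and
only the p-th factor changes, by the moment recursion. -/
theorem tiltExpect_X_mul (h : ∀ p, 2 * s * l p < 1) (p : ι) (f : MvPolynomial ι ℂ) :
    tiltExpect b h (MvPolynomial.X p * f)
      = (b p * tiltVar s (l p) : ℝ) * tiltExpect b h f
        + (tiltVar s (l p) : ℝ) * tiltExpect b h (MvPolynomial.pderiv p f) := by
  induction f using MvPolynomial.induction_on' with
  | monomial u a =>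
    rw [MvPolynomial.pderiv_monomial, MvPolynomial.X, MvPolynomial.monomial_mul,
      tiltExpect_monomial, tiltExpect_monomial, tiltExpect_monomial,
      ← Finset.mul_prod_erase _ (fun q => (tiltMoment s (l q) (b q) ((Finsupp.single p 1 + u : ι →₀ ℕ) q) : ℂ))
        (Finset.mem_univ p),
      ← Finset.mul_prod_erase _ (fun q => (tiltMoment s (l q) (b q) (u q) : ℂ)) (Finset.mem_univ p),
      ← Finset.mul_prod_erase _
        (fun q => (tiltMoment s (l q) (b q) ((u - Finsupp.single p 1 : ι →₀ ℕ) q) : ℂ)) (Finset.mem_univ p)]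
    have e1 : ∏ q ∈ Finset.univ.erase p,
        (tiltMoment s (l q) (b q) ((Finsupp.single p 1 + u : ι →₀ ℕ) q) : ℂ)
        = ∏ q ∈ Finset.univ.erase p, (tiltMoment s (l q) (b q) (u q) : ℂ) :=
      Finset.prod_congr rfl fun q hq => by
        rw [Finsupp.add_apply, Finsupp.single_eq_of_ne (Finset.ne_of_mem_erase hq), zero_add]
    have e2 : ∏ q ∈ Finset.univ.erase p,
        (tiltMoment s (l q) (b q) ((u - Finsupp.single p 1 : ι →₀ ℕ) q) : ℂ)
        = ∏ q ∈ Finset.univ.erase p, (tiltMoment s (l q) (b q) (u q) : ℂ) :=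
      Finset.prod_congr rfl fun q hq => by
        rw [Finsupp.tsub_apply, Finsupp.single_eq_of_ne (Finset.ne_of_mem_erase hq), tsub_zero]
    rw [e1, e2, Finsupp.add_apply, Finsupp.tsub_apply, Finsupp.single_eq_same, add_comm 1 (u p),
      tiltMoment_succ (h p)]
    push_cast
    ring
  | add f f' hf hf' =>
    rw [mul_add, map_add, hf, hf', map_add, map_add, map_add]
    ring

theorem pderiv_affineForm (a : ℂ) (c : ι → ℂ) (p : ι) :
    MvPolynomial.pderiv p (affineForm a c) = MvPolynomial.C (c p) := by
  simp [affineForm, MvPolynomial.pderiv_X, Pi.single_apply]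

theorem pderiv_prod_affineForm {κ : Type*} [DecidableEq κ] (a : κ → ℂ) (c : κ → ι → ℂ)
    (S : Finset κ) (p : ι) :
    MvPolynomial.pderiv p (∏ k ∈ S, affineForm (a k) (c k))
      = ∑ k ∈ S, MvPolynomial.C (c k p) * ∏ k' ∈ S.erase k, affineForm (a k') (c k') := by
  induction S using Finset.induction_on with
  | empty => simp
  | insert k S hk ih =>
    rw [Finset.prod_insert hk, Derivation.leibniz, ih, pderiv_affineForm, Finset.sum_insert hk,
      Finset.erase_insert hk, smul_eq_mul, smul_eq_mul, Finset.mul_sum]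
    rw [add_comm]
    congr 1
    · ring
    · refine Finset.sum_congr rfl fun k' hk' => ?_
      have hne : k' ≠ k := fun e => hk (e ▸ hk')
      rw [Finset.erase_insert_of_ne hne.symm, Finset.prod_insert
        (fun e => hk (Finset.mem_of_mem_erase e))]
      ring

/-- Wick's recursion for products of affine forms. -/
theorem tiltExpect_prod_insert (h : ∀ p, 2 * s * l p < 1) {κ : Type*} [DecidableEq κ]
    (a : κ → ℂ) (c : κ → ι → ℂ) {k : κ} {S : Finset κ} (hk : k ∉ S) :
    tiltExpect b h (∏ k' ∈ insert k S, affineForm (a k') (c k'))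
      = (a k + ∑ p, c k p * (b p * tiltVar s (l p) : ℝ))
          * tiltExpect b h (∏ k' ∈ S, affineForm (a k') (c k'))
        + ∑ k' ∈ S, (∑ p, c k p * c k' p * (tiltVar s (l p) : ℝ))
          * tiltExpect b h (∏ j ∈ S.erase k', affineForm (a j) (c j)) := by
  rw [Finset.prod_insert hk]
  set F := ∏ k' ∈ S, affineForm (a k') (c k') with hF
  have e1 : affineForm (a k) (c k) * F = a k • F + ∑ p, c k p • (MvPolynomial.X p * F) := by
    rw [affineForm, add_mul, Finset.sum_mul, MvPolynomial.C_mul']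
    congr 1
    exact Finset.sum_congr rfl fun p _ => by rw [mul_assoc, MvPolynomial.C_mul']
  rw [e1, map_add, map_smul, map_sum]
  simp_rw [map_smul, tiltExpect_X_mul, hF, pderiv_prod_affineForm, map_sum, MvPolynomial.C_mul',
    map_smul, smul_eq_mul, mul_add, Finset.sum_add_distrib, add_mul, Finset.sum_mul, Finset.mul_sum]
  rw [Finset.sum_comm, add_assoc]
  congr 2
  · exact Finset.sum_congr rfl fun p _ => by ring
  · exact Finset.sum_congr rfl fun k' _ => Finset.sum_congr rfl fun p _ => by ring

end Functional

/-! ### Gaussian matrices in real rotated coordinates -/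

/-- The image is jointly Gaussian with covariance cv times the identity, and uncorrelated jointly
Gaussian variables are independent. -/
theorem hasLaw_linear_of_iid_gaussianReal {Ω ι κ : Type*} [MeasurableSpace Ω] {P : Measure Ω}
    [IsProbabilityMeasure P] [Fintype ι] [Fintype κ] [DecidableEq κ] {v c : ℝ≥0} {X : ι → Ω → ℝ}
    (hX : ∀ i, HasLaw (X i) (gaussianReal 0 v) P) (hind : iIndepFun X P) {T : Matrix κ ι ℝ}
    (hT : T * T.transpose = (c : ℝ) • 1) :
    HasLaw (fun ω k => ∑ i, T k i * X i ω) (Measure.pi fun _ : κ => gaussianReal 0 (c * v)) P := by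
  classical
  have hG : HasGaussianLaw (fun ω i => X i ω) P :=
    hind.hasGaussianLaw fun i => (hX i).hasGaussianLaw
  let L : (ι → ℝ) →L[ℝ] (κ → ℝ) := LinearMap.toContinuousLinearMap T.mulVecLin
  have hY : HasGaussianLaw (fun ω k => ∑ i, T k i * X i ω) P := by
    exact hG.map_fun L
  have hL2 : ∀ i, MemLp (X i) 2 P := fun i => (hX i).hasGaussianLaw.memLp_two
  have hcovX : ∀ i j, cov[X i, X j; P] = if i = j then (v : ℝ) else 0 := by
    intro i j
    split_ifs with h
    · subst h
      rw [covariance_self (hX i).aemeasurable, (hX i).variance_eq, variance_id_gaussianReal]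
    · exact (hind.indepFun h).covariance_eq_zero (hL2 i) (hL2 j)
  have hcov : ∀ k k', cov[fun ω => ∑ i, T k i * X i ω, fun ω => ∑ i, T k' i * X i ω; P]
      = if k = k' then (c : ℝ) * v else 0 := by
    intro k k'
    have h1 := congrFun (congrFun hT k) k'
    rw [Matrix.mul_apply, Matrix.smul_apply, Matrix.one_apply] at h1
    rw [covariance_fun_sum_fun_sum (fun i => (hL2 i).const_mul _) (fun i => (hL2 i).const_mul _)]
    simp_rw [covariance_const_mul_left, covariance_const_mul_right, hcovX]
    simp only [mul_ite, mul_zero, Finset.sum_ite_eq, Finset.mem_univ, if_true]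
    simp only [Matrix.transpose_apply] at h1
    calc _ = (∑ i, T k i * T k' i) * v := by
          rw [Finset.sum_mul]; exact Finset.sum_congr rfl fun i _ => by ring
      _ = _ := by rw [h1]; split_ifs <;> simp
  have hmean : ∀ k, ∫ ω, ∑ i, T k i * X i ω ∂P = 0 := by
    intro k
    rw [integral_finsetSum _ fun i _ => ((hL2 i).integrable one_le_two).const_mul _]
    refine Finset.sum_eq_zero fun i _ => ?_
    rw [integral_const_mul, (hX i).integral_eq, integral_id_gaussianReal, mul_zero]
  refine iIndepFun.hasLaw_pi (X := fun k ω => ∑ i, T k i * X i ω) (fun k => ?_) ?_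
  · have hk := hY.eval k
    refine ⟨hk.aemeasurable, ?_⟩
    rw [hk.map_eq_gaussianReal, hmean, ← covariance_self hk.aemeasurable, hcov, if_pos rfl]
    congr 1
    rw [← NNReal.coe_mul, Real.toNNReal_coe]
  · exact hY.iIndepFun_of_covariance_eq_zero fun k k' h => by rw [hcov, if_neg h]

/-- The real (`0`) and imaginary (`1`) parts of a complex number. -/
def reIm (c : Fin 2) (w : ℂ) : ℝ := if c = 0 then w.re else w.im

theorem measurable_reIm (c : Fin 2) : Measurable (reIm c) := by
  unfold reIm
  split_ifs
  · exact Complex.measurable_re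
  · exact Complex.measurable_im

theorem hasLaw_reIm_complexGaussian (ν : ℝ≥0) :
    HasLaw (fun w c => reIm c w) (Measure.pi fun _ : Fin 2 => gaussianReal 0 (ν / 2))
      (complexGaussian ν) where
  aemeasurable := (measurable_pi_lambda _ measurable_reIm).aemeasurable
  map_eq := by
    have hm : Measurable fun p : ℝ × ℝ => (⟨p.1, p.2⟩ : ℂ) :=
      Complex.measurableEquivRealProd.symm.measurable
    rw [complexGaussian, Measure.map_map (measurable_pi_lambda _ measurable_reIm) hm,
      ← (measurePreserving_finTwoArrow (gaussianReal 0 (ν / 2))).symm.map_eq]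
    congr 1
    ext p c
    fin_cases c <;> rfl

instance (ν : ℝ≥0) : IsProbabilityMeasure (complexGaussian ν) :=
  Measure.isProbabilityMeasure_map
    (Complex.measurableEquivRealProd.symm.measurable (α := ℝ × ℝ)).aemeasurable

theorem HasLaw.pi_eval {ι : Type*} [Fintype ι] {Ω E : Type*} [MeasurableSpace Ω]
    [MeasurableSpace E] {P : Measure Ω} {μ : ι → Measure E} [∀ i, IsProbabilityMeasure (μ i)]
    {X : Ω → ι → E} (hX : HasLaw X (Measure.pi μ) P) (i : ι) :
    HasLaw (fun ω => X ω i) (μ i) P :=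
  HasLaw.comp ⟨(measurable_pi_apply i).aemeasurable, (measurePreserving_eval μ i).map_eq⟩ hX

/-- The real coordinates of a complex matrix. -/
def realCoord {n : ℕ} (A : Matrix (Fin n) (Fin n) ℂ) (p : (Fin n × Fin n) × Fin 2) : ℝ :=
  reIm p.2 (A p.1.1 p.1.2)

theorem hasLaw_realCoord {n : ℕ} {ν : ℝ≥0} {Ω : Type*} [MeasurableSpace Ω] {P : Measure Ω}
    [IsProbabilityMeasure P] {W : Ω → Matrix (Fin n) (Fin n) ℂ}
    (hW : IsComplexGaussianMatrix P ν W) :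
    HasLaw (fun ω => realCoord (W ω)) (Measure.pi fun _ => gaussianReal 0 (ν / 2)) P := by
  have h1 : HasLaw (fun ω (p : Fin n × Fin n) => W ω p.1 p.2)
      (Measure.pi fun _ => complexGaussian ν) P :=
    iIndepFun.hasLaw_pi (X := fun (p : Fin n × Fin n) ω => W ω p.1 p.2)
      (fun p => hW.hasLaw p.1 p.2) hW.indep
  have h2 : HasLaw (fun (x : Fin n × Fin n → ℂ) (p : (Fin n × Fin n) × Fin 2) => reIm p.2 (x p.1))
      (Measure.pi fun _ => gaussianReal 0 (ν / 2)) (Measure.pi fun _ => complexGaussian ν) := by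
    have hlaw : ∀ p : Fin n × Fin n, HasLaw (fun (x : Fin n × Fin n → ℂ) c => reIm c (x p))
        (Measure.pi fun _ : Fin 2 => gaussianReal 0 (ν / 2)) (Measure.pi fun _ => complexGaussian ν) :=
      fun p => HasLaw.comp (hasLaw_reIm_complexGaussian ν) 
        (HasLaw.pi_eval (X := id) (μ := fun _ => complexGaussian ν) HasLaw.id p)
    refine iIndepFun.hasLaw_pi (X := fun (p : (Fin n × Fin n) × Fin 2) (x : Fin n × Fin n → ℂ) =>
      reIm p.2 (x p.1)) (fun p => HasLaw.pi_eval (hlaw p.1) p.2) ?_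
    refine iIndepFun_uncurry' (X := fun (p : Fin n × Fin n) c (x : Fin n × Fin n → ℂ) =>
      reIm c (x p)) (fun p c => (measurable_reIm c).comp (measurable_pi_apply p)) ?_ fun p => ?_
    · exact iIndepFun_pi (X := fun _ w c => reIm c w)
        fun _ => (measurable_pi_lambda _ measurable_reIm).aemeasurable
    · exact (iIndepFun_iff_hasLaw_pi_pi fun c => HasLaw.pi_eval (hlaw p) c).2 (hlaw p)
  exact HasLaw.comp h2 h1

open Kronecker in
/-- The coordinates of `O (z W) Oᵀ` are i.i.d. real Gaussians when `O` is orthogonal. -/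
theorem hasLaw_realCoord_conj {n : ℕ} {ν : ℝ≥0} {Ω : Type*} [MeasurableSpace Ω] {P : Measure Ω}
    [IsProbabilityMeasure P] {W : Ω → Matrix (Fin n) (Fin n) ℂ}
    (hW : IsComplexGaussianMatrix P ν W) (z : ℂ) {O : Matrix (Fin n) (Fin n) ℝ}
    (hO : O * O.transpose = 1) :
    HasLaw (fun ω => realCoord (O.map Complex.ofReal * (z • W ω) * (O.map Complex.ofReal).transpose))
      (Measure.pi fun _ => gaussianReal 0 (‖z‖₊ ^ 2 * (ν / 2))) P := by
  have hX := hasLaw_realCoord hW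
  let R : Matrix (Fin 2) (Fin 2) ℝ := !![z.re, -z.im; z.im, z.re]
  have hR : R * R.transpose = (‖z‖ ^ 2) • (1 : Matrix (Fin 2) (Fin 2) ℝ) := by
    rw [← Complex.normSq_eq_norm_sq, Complex.normSq_apply]
    ext i j
    fin_cases i <;> fin_cases j <;> simp [R, Matrix.mul_apply, Fin.sum_univ_two] <;> ring
  -- In real coordinates, W ↦ O(zW)Oᵀ is O ⊗ O on the matrix indices and multiplication by z, the
  -- scaled rotation R, on the real and imaginary parts.
  have hT : ((O ⊗ₖ O) ⊗ₖ R) * ((O ⊗ₖ O) ⊗ₖ R).transpose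
      = ((‖z‖₊ ^ 2 : ℝ≥0) : ℝ) • (1 : Matrix ((Fin n × Fin n) × Fin 2) _ ℝ) := by
    rw [← Matrix.kroneckerMap_transpose, ← Matrix.kroneckerMap_transpose, ← Matrix.mul_kronecker_mul,
      ← Matrix.mul_kronecker_mul, hO, hR, Matrix.one_kronecker_one, Matrix.kronecker_smul,
      Matrix.one_kronecker_one]
    simp
  have := hasLaw_linear_of_iid_gaussianReal (fun p => HasLaw.pi_eval hX p)
    ((iIndepFun_iff_hasLaw_pi_pi fun p => HasLaw.pi_eval hX p).2 hX) hT
  convert this using 3 with ω p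
  obtain ⟨⟨k, l⟩, c⟩ := p
  rw [Fintype.sum_prod_type, Fintype.sum_prod_type, Finset.sum_comm]
  simp only [realCoord, Matrix.mul_apply, Matrix.transpose_apply, Matrix.map_apply, Finset.sum_mul,
    Matrix.smul_apply, smul_eq_mul, Matrix.kroneckerMap_apply, Fin.sum_univ_two]
  have hre : ∀ a : Fin n → Fin n → ℂ, reIm c (∑ j, ∑ i, a i j) = ∑ j, ∑ i, reIm c (a i j) := by
    intro a
    unfold reIm
    split_ifs <;> simp
  rw [hre]
  refine Finset.sum_congr rfl fun j _ => Finset.sum_congr rfl fun i _ => ?_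
  fin_cases c <;> simp [reIm, R] <;> ring

/-! ### Averages over the symmetric group -/

section PermSums

variable {n : ℕ}

theorem card_mul_sum_perm_apply (f : Fin n → ℂ) (i : Fin n) :
    (n : ℂ) * ∑ σ : Equiv.Perm (Fin n), f (σ i) = (n ! : ℂ) * ∑ k, f k := by
  have h1 : ∀ j : Fin n, ∑ σ : Equiv.Perm (Fin n), f (σ j) = ∑ σ : Equiv.Perm (Fin n), f (σ i) := by
    intro j
    refine Fintype.sum_equiv (Equiv.mulRight (Equiv.swap i j)) _ _ fun σ => ?_
    simp
  have h2 : ∑ j : Fin n, ∑ σ : Equiv.Perm (Fin n), f (σ j) = (n ! : ℂ) * ∑ k, f k := by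
    rw [Finset.sum_comm]
    simp_rw [Equiv.sum_comp]
    simp [Fintype.card_perm]
  rw [← h2, Finset.sum_congr rfl fun j _ => h1 j]
  simp

theorem exists_perm_apply_pair {i j i' j' : Fin n} (h : i ≠ j) (h' : i' ≠ j') :
    ∃ τ : Equiv.Perm (Fin n), τ i = i' ∧ τ j = j' := by
  refine ⟨Equiv.swap (Equiv.swap i i' j) j' * Equiv.swap i i', ?_, by simp⟩
  rw [Equiv.Perm.mul_apply, Equiv.swap_apply_left]
  refine Equiv.swap_apply_of_ne_of_ne (fun e => h ?_) h'
  rw [← (Equiv.swap i i').injective.eq_iff, ← e, Equiv.swap_apply_left]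

/-- By double transitivity the sum over σ is the same for every ordered pair of distinct indices, so
it can be averaged over all such pairs. The form without division also covers n(n-1) = 0. -/
theorem card_mul_sum_perm_apply_pair (f : Fin n → Fin n → ℂ) {i j : Fin n} (h : i ≠ j) :
    (n * (n - 1) : ℂ) * ∑ σ : Equiv.Perm (Fin n), f (σ i) (σ j)
      = (n ! : ℂ) * ∑ k, ∑ l ∈ Finset.univ.erase k, f k l := by
  have h1 : ∀ i', ∀ j' ∈ Finset.univ.erase i', ∑ σ : Equiv.Perm (Fin n), f (σ i') (σ j')
      = ∑ σ : Equiv.Perm (Fin n), f (σ i) (σ j) := by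
    intro i' j' hj
    obtain ⟨τ, rfl, rfl⟩ := exists_perm_apply_pair h (Finset.ne_of_mem_erase hj).symm
    exact Fintype.sum_equiv (Equiv.mulRight τ) _ _ fun σ => by simp
  have h2 : ∑ i', ∑ j' ∈ Finset.univ.erase i', ∑ σ : Equiv.Perm (Fin n), f (σ i') (σ j')
      = (n ! : ℂ) * ∑ k, ∑ l ∈ Finset.univ.erase k, f k l := by
    rw [Finset.sum_congr rfl fun i' _ => Finset.sum_comm, Finset.sum_comm]
    have : ∀ σ : Equiv.Perm (Fin n), ∑ i', ∑ j' ∈ Finset.univ.erase i', f (σ i') (σ j')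
        = ∑ k, ∑ l ∈ Finset.univ.erase k, f k l := by
      intro σ
      refine Fintype.sum_equiv σ _ _ fun i' => ?_
      refine Finset.sum_equiv σ (fun j' => by simp) fun _ _ => rfl
    rw [Finset.sum_congr rfl fun σ _ => this σ]
    simp [Fintype.card_perm, mul_sub]
  rw [← h2, Finset.sum_congr rfl fun i' _ => Finset.sum_congr rfl fun j' hj => h1 i' j' hj]
  have hn : 0 < n := Fin.pos i
  simp [Nat.cast_sub (show 1 ≤ n from hn)]
  ring

/-- Inclusion-exclusion over coinciding rows and coinciding columns. -/
theorem sum_sum_erase_mul (A : Matrix (Fin n) (Fin n) ℂ) :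
    ∑ i, ∑ j ∈ Finset.univ.erase i, ∑ k, ∑ l ∈ Finset.univ.erase k, A k i * A l j
      = (∑ i, ∑ j, A i j) ^ 2 - ∑ i, (∑ j, A i j) ^ 2 - ∑ j, (∑ i, A i j) ^ 2
        + ∑ i, ∑ j, A i j ^ 2 := by
  have e : ∀ (f : Fin n → ℂ) (k : Fin n), ∑ l ∈ Finset.univ.erase k, f l = ∑ l, f l - f k :=
    fun f k => by rw [← Finset.add_sum_erase _ f (Finset.mem_univ k)]; ring
  have h1 : ∀ i j, ∑ k, ∑ l ∈ Finset.univ.erase k, A k i * A l j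
      = (∑ k, A k i) * (∑ l, A l j) - ∑ k, A k i * A k j := by
    intro i j
    rw [Finset.sum_mul, ← Finset.sum_sub_distrib]
    refine Finset.sum_congr rfl fun k _ => ?_
    rw [← Finset.mul_sum, e (fun l => A l j), mul_sub]
  have h2 : ∑ i, ∑ j, ∑ k, A k i * A k j = ∑ k, (∑ j, A k j) ^ 2 := by
    simp_rw [pow_two, Finset.sum_mul_sum]
    rw [Finset.sum_congr rfl fun i _ => Finset.sum_comm, Finset.sum_comm]
  have h3 : ∑ i, ∑ k, A k i * A k i = ∑ k, ∑ i, A k i ^ 2 := by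
    rw [Finset.sum_comm]; simp_rw [pow_two]
  have h4 : ∑ i, ∑ j, (∑ k, A k i) * (∑ l, A l j) = (∑ i, ∑ j, A i j) ^ 2 := by
    rw [← Finset.sum_mul_sum, Finset.sum_comm, pow_two]
  simp_rw [h1, e, Finset.sum_sub_distrib]
  rw [h2, h3, h4]
  simp_rw [pow_two]
  ring

end PermSums

/-! ### The first two logarithmic derivatives of the permanent -/

section LogDeriv

variable {n : ℕ} (W : Matrix (Fin n) (Fin n) ℂ)

theorem normalizedPermanent_eq (z : ℂ) : normalizedPermanent W z
    = (∑ σ : Equiv.Perm (Fin n), ∏ i, (1 + z * W (σ i) i)) / (n ! : ℂ) := by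
  simp [normalizedPermanent, Matrix.permanent]

theorem normalizedPermanent_zero : normalizedPermanent W 0 = 1 := by
  rw [normalizedPermanent_eq]
  simp [Fintype.card_perm, Nat.factorial_ne_zero]

theorem hasDerivAt_normalizedPermanent (z : ℂ) : HasDerivAt (normalizedPermanent W)
    ((∑ σ : Equiv.Perm (Fin n), ∑ i, (∏ j ∈ Finset.univ.erase i, (1 + z * W (σ j) j)) * W (σ i) i)
      / (n ! : ℂ)) z := by
  rw [show normalizedPermanent W = _ from funext (normalizedPermanent_eq W)]
  refine HasDerivAt.div_const (HasDerivAt.fun_sum fun σ _ => ?_) _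
  have := HasDerivAt.fun_finsetProd (u := Finset.univ) (f := fun i z => 1 + z * W (σ i) i)
    (f' := fun i => W (σ i) i) (x := z)
    fun i _ => by simpa using ((hasDerivAt_id z).mul_const (W (σ i) i)).const_add 1
  simpa using this

theorem hasDerivAt_deriv_normalizedPermanent :
    HasDerivAt (deriv (normalizedPermanent W))
      ((∑ σ : Equiv.Perm (Fin n), ∑ i, ∑ j ∈ Finset.univ.erase i, W (σ i) i * W (σ j) j)
        / (n ! : ℂ)) 0 := by
  rw [show deriv (normalizedPermanent W) = _ from
    funext fun z => (hasDerivAt_normalizedPermanent W z).deriv]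
  refine HasDerivAt.div_const (HasDerivAt.fun_sum fun σ _ => HasDerivAt.fun_sum fun i _ => ?_) _
  have := (HasDerivAt.fun_finsetProd (u := Finset.univ.erase i) (f := fun i z => 1 + z * W (σ i) i)
    (f' := fun i => W (σ i) i) (x := 0)
    fun i _ => by simpa using ((hasDerivAt_id 0).mul_const (W (σ i) i)).const_add 1).mul_const
      (W (σ i) i)
  refine this.congr_deriv ?_
  rw [Finset.sum_mul]
  exact Finset.sum_congr rfl fun j _ => by simp [mul_comm]

theorem deriv_normalizedPermanent_zero :
    deriv (normalizedPermanent W) 0 = (∑ i, ∑ j, W i j) / n := by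
  rw [(hasDerivAt_normalizedPermanent W 0).deriv]
  simp only [zero_mul, add_zero, Finset.prod_const_one, one_mul]
  rcases Nat.eq_zero_or_pos n with rfl | hn
  · simp
  have hn' : (n : ℂ) ≠ 0 := by exact_mod_cast hn.ne'
  have hf : (n ! : ℂ) ≠ 0 := by exact_mod_cast Nat.factorial_ne_zero n
  rw [div_eq_div_iff hf hn', Finset.sum_comm, mul_comm, Finset.mul_sum,
    Finset.sum_congr rfl fun i _ => card_mul_sum_perm_apply (fun k => W k i) i, ← Finset.mul_sum,
    Finset.sum_comm]
  ring

theorem logPermanentDeriv_one : logPermanentDeriv 1 W = (∑ i, ∑ j, W i j) / n := by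
  rw [logPermanentDeriv, iteratedDeriv_one, ← deriv_normalizedPermanent_zero]
  have := (hasDerivAt_normalizedPermanent W 0).clog (by rw [normalizedPermanent_zero]; simp)
  rw [this.deriv, normalizedPermanent_zero, (hasDerivAt_normalizedPermanent W 0).deriv, div_one]

theorem logPermanentDeriv_two : logPermanentDeriv 2 W
    = ((∑ i, ∑ j, W i j) ^ 2 - ∑ i, (∑ j, W i j) ^ 2 - ∑ j, (∑ i, W i j) ^ 2
        + ∑ i, ∑ j, W i j ^ 2) / (n * (n - 1)) - ((∑ i, ∑ j, W i j) / n) ^ 2 := by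
  have hd : ∀ z, HasDerivAt (normalizedPermanent W) (deriv (normalizedPermanent W) z) z :=
    fun z => (hasDerivAt_normalizedPermanent W z).differentiableAt.hasDerivAt
  have hev : (deriv fun z => Complex.log (normalizedPermanent W z)) =ᶠ[nhds 0]
      fun z => deriv (normalizedPermanent W) z / normalizedPermanent W z := by
    have hc : ContinuousAt (normalizedPermanent W) 0 := (hd 0).continuousAt
    have : ∀ᶠ z in nhds 0, normalizedPermanent W z ∈ Complex.slitPlane :=
      hc.eventually_mem (Complex.isOpen_slitPlane.mem_nhds (by
        rw [normalizedPermanent_zero]; simp))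
    filter_upwards [this] with z hz
    exact ((hd z).clog hz).deriv
  rw [logPermanentDeriv, iteratedDeriv_succ, iteratedDeriv_one, hev.deriv_eq]
  have h2 := (hasDerivAt_deriv_normalizedPermanent W).fun_div (hd 0)
    (by rw [normalizedPermanent_zero]; simp)
  rw [h2.deriv, normalizedPermanent_zero, deriv_normalizedPermanent_zero, ← sum_sum_erase_mul]
  have key : (∑ σ : Equiv.Perm (Fin n), ∑ i, ∑ j ∈ Finset.univ.erase i, W (σ i) i * W (σ j) j)
      / (n ! : ℂ) = (∑ i, ∑ j ∈ Finset.univ.erase i, ∑ k, ∑ l ∈ Finset.univ.erase k,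
        W k i * W l j) / (n * (n - 1)) := by
    have hf : (n ! : ℂ) ≠ 0 := by exact_mod_cast Nat.factorial_ne_zero n
    by_cases hn : (n * (n - 1) : ℂ) = 0
    -- For n ≤ 1 there are no pairs of distinct indices, and division by n(n-1) = 0 gives 0, so both
    -- sides vanish.
    · have hn1 : n ≤ 1 := by
        rcases mul_eq_zero.1 hn with h | h
        · have : n = 0 := by exact_mod_cast h
          omega
        · have : n = 1 := by exact_mod_cast sub_eq_zero.1 h
          omega
      have : ∀ i : Fin n, Finset.univ.erase i = ∅ := fun i => by
        ext j
        have : j = i := by ext; omega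
        simp [this]
      simp [this]
    · rw [div_eq_div_iff hf hn, Finset.sum_comm, mul_comm, Finset.mul_sum,
        mul_comm _ (n ! : ℂ), Finset.mul_sum]
      refine Finset.sum_congr rfl fun i _ => ?_
      rw [Finset.sum_comm, Finset.mul_sum, Finset.mul_sum]
      exact Finset.sum_congr rfl fun j hj =>
        card_mul_sum_perm_apply_pair (fun k l => W k i * W l j) (Finset.ne_of_mem_erase hj).symm
  rw [key]
  ring

end LogDeriv

/-! ### An orthogonal matrix with constant first row -/

section Rotation

theorem exists_orthogonal_const_row (m : ℕ) : ∃ O : Matrix (Fin (m + 1)) (Fin (m + 1)) ℝ,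
    O * O.transpose = 1 ∧ ∀ j, O 0 j = (√(m + 1))⁻¹ := by
  have hpos : (0 : ℝ) < m + 1 := by positivity
  let v : Fin (m + 1) → EuclideanSpace ℝ (Fin (m + 1)) :=
    fun _ => WithLp.toLp 2 fun _ => (√(m + 1))⁻¹
  have hv : Orthonormal ℝ (({0} : Set (Fin (m + 1))).domRestrict v) := by
    refine ⟨fun i => ?_, fun i j hij => (hij (Subsingleton.elim _ _)).elim⟩
    rw [EuclideanSpace.norm_eq]
    simp [v, Set.domRestrict, Real.sq_sqrt hpos.le, hpos.ne']
  obtain ⟨b, hb⟩ := hv.exists_orthonormalBasis_extension_of_card_eq (by simp)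
  refine ⟨Matrix.of fun i j => b i j, ?_, fun j => ?_⟩
  · ext i k
    have := orthonormal_iff_ite.1 b.orthonormal k i
    rw [PiLp.inner_apply] at this
    simp only [Matrix.mul_apply, Matrix.transpose_apply, Matrix.of_apply, Matrix.one_apply]
    simp only [RCLike.inner_apply, conj_trivial] at this
    rw [this]
    exact if_congr eq_comm rfl rfl
  · rw [Matrix.of_apply, hb 0 rfl]

end Rotation

/-! ### Coincidences of two random permutations -/

section FixedPoints

variable {n : ℕ}

theorem card_perm_fixing (I : Finset (Fin n)) :
    (Finset.univ.filter fun ρ : Equiv.Perm (Fin n) => ∀ i ∈ I, ρ i = i).card = (n - I.card)! := by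
  rw [← Fintype.card_subtype]
  have e := Equiv.Perm.subtypeEquivSubtypePerm fun i : Fin n => i ∉ I
  have h := Fintype.card_congr e
  rw [Fintype.card_perm, Fintype.card_subtype_compl] at h
  simp only [Fintype.card_coe, Fintype.card_fin, not_not] at h
  rw [h]

/-- Expanding over sets I of prescribed fixed points, each I is fixed pointwise by (n - |I|)!
permutations; sets of size k contribute n! t^k/k! in all, a truncated exponential series. -/
theorem sum_perm_prod_fixed_le (t : ℝ) (ht : 0 ≤ t) :
    ∑ ρ : Equiv.Perm (Fin n), ∏ i, (1 + if ρ i = i then t else 0) ≤ n ! * Real.exp t := by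
  have h1 : ∀ ρ : Equiv.Perm (Fin n), ∏ i, (1 + if ρ i = i then t else 0)
      = ∑ I : Finset (Fin n), if ∀ i ∈ I, ρ i = i then t ^ I.card else 0 := by
    intro ρ
    rw [Finset.prod_one_add, Finset.powerset_univ]
    refine Finset.sum_congr rfl fun I _ => ?_
    split_ifs with h
    · rw [← Finset.prod_const]
      exact Finset.prod_congr rfl fun i hi => if_pos (h i hi)
    · push Not at h
      obtain ⟨i, hi, hne⟩ := h
      exact Finset.prod_eq_zero hi (if_neg hne)
  simp_rw [h1]
  rw [Finset.sum_comm]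
  have h2 : ∀ I : Finset (Fin n), ∑ ρ : Equiv.Perm (Fin n),
      (if ∀ i ∈ I, ρ i = i then t ^ I.card else 0) = ((n - I.card)! : ℝ) * t ^ I.card := by
    intro I
    rw [← Finset.sum_filter, Finset.sum_const, card_perm_fixing, nsmul_eq_mul]
  rw [Finset.sum_congr rfl fun I _ => h2 I, ← Finset.powerset_univ,
    Finset.sum_powerset_apply_card (fun k => ((n - k)! : ℝ) * t ^ k), Finset.card_univ,
    Fintype.card_fin]
  refine le_trans (le_of_eq ?_) (mul_le_mul_of_nonneg_left (Real.sum_le_exp_of_nonneg ht (n + 1))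
    (Nat.cast_nonneg _))
  rw [Finset.mul_sum]
  refine Finset.sum_congr rfl fun k hk => ?_
  have hk' : k ≤ n := Nat.lt_succ_iff.1 (Finset.mem_range.1 hk)
  have := Nat.choose_mul_factorial_mul_factorial hk'
  have h3 : (n ! : ℝ) = n.choose k * k ! * (n - k)! := by exact_mod_cast this.symm
  have hk0 : (k ! : ℝ) ≠ 0 := by exact_mod_cast Nat.factorial_ne_zero k
  rw [nsmul_eq_mul, h3]
  field_simp

theorem sum_perm_perm_prod_eq (t : ℝ) :
    ∑ σ : Equiv.Perm (Fin n), ∑ τ : Equiv.Perm (Fin n), ∏ i, (1 + if σ i = τ i then t else 0)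
      = n ! * ∑ ρ : Equiv.Perm (Fin n), ∏ i, (1 + if ρ i = i then t else 0) := by
  have : ∀ σ : Equiv.Perm (Fin n), ∑ τ : Equiv.Perm (Fin n), ∏ i, (1 + if σ i = τ i then t else 0)
      = ∑ ρ : Equiv.Perm (Fin n), ∏ i, (1 + if ρ i = i then t else 0) := by
    intro σ
    refine Fintype.sum_equiv (Equiv.mulLeft σ⁻¹) _ _ fun τ => ?_
    refine Finset.prod_congr rfl fun i _ => ?_
    simp only [Equiv.coe_mulLeft, Equiv.Perm.mul_apply, Equiv.Perm.inv_eq_iff_eq]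
    simp only [eq_comm]
  rw [Finset.sum_congr rfl fun σ _ => this σ]
  simp [Fintype.card_perm]

end FixedPoints

/-! ### The reweighting exponent in rotated coordinates -/

section Conjugation

variable {m : ℕ}

/-- The coefficients of the second logarithmic derivative in rotated coordinates. -/
noncomputable def logCoeff (m : ℕ) (k l : Fin (m + 1)) : ℝ :=
  if k = 0 ∨ l = 0 then 1 / (m + 1) else -(1 / ((m + 1) * m))

/-- `O A Oᵀ`, for a real matrix `O`. -/
noncomputable def conjReal {n : ℕ} (O : Matrix (Fin n) (Fin n) ℝ) (A : Matrix (Fin n) (Fin n) ℂ) :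
    Matrix (Fin n) (Fin n) ℂ :=
  O.map Complex.ofReal * A * (O.map Complex.ofReal).transpose

theorem conjReal_apply {n : ℕ} (O : Matrix (Fin n) (Fin n) ℝ) (A : Matrix (Fin n) (Fin n) ℂ)
    (k l : Fin n) : conjReal O A k l = ∑ j, ∑ i, (O k i : ℂ) * A i j * O l j := by
  simp [conjReal, Matrix.mul_apply, Finset.sum_mul]

theorem transpose_map_mul_map {n : ℕ} {O : Matrix (Fin n) (Fin n) ℝ} (hO : O * O.transpose = 1) :
    (O.map Complex.ofReal).transpose * O.map Complex.ofReal = 1 := by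
  have h := mul_eq_one_comm.1 hO
  have := congrArg (fun M => M.map Complex.ofRealHom) h
  simp only [Matrix.map_mul, Matrix.map_one _ (map_zero _) (map_one _)] at this
  exact this

theorem eq_conjReal_transpose {n : ℕ} {O : Matrix (Fin n) (Fin n) ℝ} (hO : O * O.transpose = 1)
    (A : Matrix (Fin n) (Fin n) ℂ) (i j : Fin n) :
    A i j = ∑ l, ∑ k, (O k i : ℂ) * O l j * conjReal O A k l := by
  have h : (O.map Complex.ofReal).transpose * conjReal O A * O.map Complex.ofReal = A := by
    rw [conjReal, ← mul_assoc, ← mul_assoc, transpose_map_mul_map hO, one_mul, mul_assoc,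
      transpose_map_mul_map hO, mul_one]
  conv_lhs => rw [← h]
  simp only [Matrix.mul_apply, Finset.sum_mul, Matrix.transpose_apply, Matrix.map_apply]
  exact Finset.sum_congr rfl fun l _ => Finset.sum_congr rfl fun k _ => by ring

/-- The squares are taken without conjugation, so this is invariance of the complex bilinear form
and needs O real orthogonal. It transfers to B the row, column and total sums of squares occurring
in D₂. -/
theorem sum_sq_mulVec {n : ℕ} {O : Matrix (Fin n) (Fin n) ℝ} (hO : O * O.transpose = 1)
    (x : Fin n → ℂ) : ∑ k, (∑ i, (O k i : ℂ) * x i) ^ 2 = ∑ i, x i ^ 2 := by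
  have h : ∀ i j, ∑ k, (O k i : ℂ) * O k j = if i = j then 1 else 0 := fun i j => by
    have := congrFun (congrFun (transpose_map_mul_map hO) i) j
    simpa [Matrix.mul_apply, Matrix.one_apply] using this
  calc ∑ k, (∑ i, (O k i : ℂ) * x i) ^ 2
      = ∑ k, ∑ i, ∑ j, (O k i : ℂ) * O k j * (x i * x j) := by
        refine Finset.sum_congr rfl fun k _ => ?_
        rw [pow_two, Finset.sum_mul_sum]
        exact Finset.sum_congr rfl fun i _ => Finset.sum_congr rfl fun j _ => by ring
    _ = ∑ i, ∑ j, (∑ k, (O k i : ℂ) * O k j) * (x i * x j) := by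
        rw [Finset.sum_comm]
        refine Finset.sum_congr rfl fun i _ => ?_
        rw [Finset.sum_comm]
        simp_rw [Finset.sum_mul]
    _ = ∑ i, x i ^ 2 := by simp [h, pow_two]

theorem sum_sum_sq_conjReal {n : ℕ} {O : Matrix (Fin n) (Fin n) ℝ} (hO : O * O.transpose = 1)
    (A : Matrix (Fin n) (Fin n) ℂ) : ∑ k, ∑ l, conjReal O A k l ^ 2 = ∑ i, ∑ j, A i j ^ 2 := by
  have h1 : ∀ k, ∑ l, conjReal O A k l ^ 2 = ∑ j, (∑ i, (O k i : ℂ) * A i j) ^ 2 := by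
    intro k
    rw [← sum_sq_mulVec hO fun j => ∑ i, (O k i : ℂ) * A i j]
    refine Finset.sum_congr rfl fun l _ => ?_
    rw [conjReal_apply]
    congr 1
    refine Finset.sum_congr rfl fun j _ => ?_
    rw [Finset.mul_sum]
    exact Finset.sum_congr rfl fun i _ => by ring
  rw [Finset.sum_congr rfl fun k _ => h1 k, Finset.sum_comm]
  rw [Finset.sum_congr rfl fun j _ => sum_sq_mulVec hO fun i => A i j, Finset.sum_comm]

variable {O : Matrix (Fin (m + 1)) (Fin (m + 1)) ℝ}

theorem conjReal_zero_zero (h0 : ∀ j, O 0 j = (√(m + 1))⁻¹)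
    (A : Matrix (Fin (m + 1)) (Fin (m + 1)) ℂ) :
    conjReal O A 0 0 = (∑ i, ∑ j, A i j) / (m + 1) := by
  have hs : ((√(m + 1))⁻¹ : ℂ) * (√(m + 1) : ℂ)⁻¹ = (m + 1 : ℂ)⁻¹ := by
    rw [← mul_inv, ← Complex.ofReal_mul, Real.mul_self_sqrt (by positivity)]
    push_cast; rfl
  rw [conjReal_apply, Finset.sum_comm, div_eq_mul_inv, ← hs, Finset.sum_mul]
  refine Finset.sum_congr rfl fun i _ => ?_
  rw [Finset.sum_mul]
  refine Finset.sum_congr rfl fun j _ => ?_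
  rw [h0, h0]
  push_cast
  ring

theorem sum_sq_conjReal_zero_right (hO : O * O.transpose = 1) (h0 : ∀ j, O 0 j = (√(m + 1))⁻¹)
    (A : Matrix (Fin (m + 1)) (Fin (m + 1)) ℂ) :
    ∑ k, conjReal O A k 0 ^ 2 = (∑ i, (∑ j, A i j) ^ 2) / (m + 1) := by
  have hs : ((√(m + 1) : ℂ)⁻¹) ^ 2 = (m + 1 : ℂ)⁻¹ := by
    rw [inv_pow, ← Complex.ofReal_pow, Real.sq_sqrt (by positivity)]
    push_cast; rfl
  rw [div_eq_mul_inv, ← hs, Finset.sum_mul]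
  simp_rw [← mul_pow]
  rw [← sum_sq_mulVec hO fun i => (∑ j, A i j) * (√(m + 1) : ℂ)⁻¹]
  refine Finset.sum_congr rfl fun k _ => ?_
  rw [conjReal_apply, Finset.sum_comm]
  congr 1
  refine Finset.sum_congr rfl fun i _ => ?_
  rw [Finset.sum_mul, Finset.mul_sum]
  refine Finset.sum_congr rfl fun j _ => ?_
  rw [h0]
  push_cast
  ring

theorem sum_sq_conjReal_zero_left (hO : O * O.transpose = 1) (h0 : ∀ j, O 0 j = (√(m + 1))⁻¹)
    (A : Matrix (Fin (m + 1)) (Fin (m + 1)) ℂ) :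
    ∑ l, conjReal O A 0 l ^ 2 = (∑ j, (∑ i, A i j) ^ 2) / (m + 1) := by
  have := sum_sq_conjReal_zero_right hO h0 A.transpose
  rw [show (∑ j, (∑ i, A i j) ^ 2) = ∑ i, (∑ j, A.transpose i j) ^ 2 from rfl, ← this]
  refine Finset.sum_congr rfl fun l _ => ?_
  rw [conjReal_apply, conjReal_apply, Finset.sum_comm]
  congr 1
  exact Finset.sum_congr rfl fun i _ => Finset.sum_congr rfl fun j _ => by
    rw [Matrix.transpose_apply]; ring

/-- Inclusion-exclusion for the union of the first row and the first column, on which the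
coefficient takes one value, with a second value elsewhere. -/
theorem sum_logCoeff_mul (B : Fin (m + 1) → Fin (m + 1) → ℂ) :
    ∑ k, ∑ l, (logCoeff m k l : ℂ) * B k l
      = (∑ k, B k 0 + ∑ l, B 0 l - B 0 0) / (m + 1)
        - (∑ k, ∑ l, B k l - (∑ k, B k 0 + ∑ l, B 0 l - B 0 0)) / ((m + 1) * m) := by
  have h : ∀ k l, (logCoeff m k l : ℂ) * B k l
      = ((1 / (m + 1) + 1 / ((m + 1) * m) : ℂ)) * ((if k = 0 then B k l else 0)
          + (if l = 0 then B k l else 0) - (if k = 0 then if l = 0 then B k l else 0 else 0))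
        - 1 / ((m + 1) * m) * B k l := by
    intro k l
    unfold logCoeff
    by_cases hk : k = 0 <;> by_cases hl : l = 0 <;> simp [hk, hl] <;> ring
  simp_rw [h, Finset.sum_sub_distrib, ← Finset.mul_sum, Finset.sum_sub_distrib,
    Finset.sum_add_distrib]
  have e1 : ∑ k : Fin (m + 1), ∑ l, (if k = 0 then B k l else 0) = ∑ l, B 0 l := by
    rw [Finset.sum_comm]; simp
  have e2 : ∑ k : Fin (m + 1), ∑ l, (if l = 0 then B k l else 0) = ∑ k, B k 0 := by simp
  have e3 : ∑ k : Fin (m + 1), ∑ l, (if k = 0 then if l = 0 then B k l else 0 else 0) = B 0 0 := by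
    rw [Finset.sum_comm]; simp
  rw [e1, e2, e3]
  ring

/-- The exponent of the reweighting factor in rotated coordinates. -/
theorem exponent_eq (hO : O * O.transpose = 1) (h0 : ∀ j, O 0 j = (√(m + 1))⁻¹)
    (W : Matrix (Fin (m + 1)) (Fin (m + 1)) ℂ) (z : ℂ) :
    -z * logPermanentDeriv 1 W - z ^ 2 / 2 * logPermanentDeriv 2 W
      = -conjReal O (z • W) 0 0
        + (∑ k, ∑ l, (logCoeff m k l : ℂ) * conjReal O (z • W) k l ^ 2) / 2 := by
  rw [sum_logCoeff_mul, sum_sq_conjReal_zero_right hO h0, sum_sq_conjReal_zero_left hO h0,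
    sum_sum_sq_conjReal hO, conjReal_zero_zero h0, logPermanentDeriv_one, logPermanentDeriv_two]
  simp only [Matrix.smul_apply, smul_eq_mul, ← Finset.mul_sum, mul_pow]
  push_cast
  have hm1 : (m + 1 : ℂ) ≠ 0 := by exact_mod_cast Nat.succ_ne_zero m
  -- For m = 0 the only index is (0, 0), so the coefficient with denominator m never occurs.
  rcases Nat.eq_zero_or_pos m with rfl | hm
  · simp
    ring
  · have hm0 : (m : ℂ) ≠ 0 := by exact_mod_cast hm.ne'
    rw [add_sub_cancel_right]
    field_simp
    ring

/-- The quadratic part of the real exponent, on real and imaginary coordinates. -/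
noncomputable def quadCoeff (m : ℕ) (p : (Fin (m + 1) × Fin (m + 1)) × Fin 2) : ℝ :=
  if p.2 = 0 then logCoeff m p.1.1 p.1.2 else -logCoeff m p.1.1 p.1.2

/-- The linear part of the real exponent. -/
noncomputable def linCoeff (m : ℕ) (p : (Fin (m + 1) × Fin (m + 1)) × Fin 2) : ℝ :=
  if p = ((0, 0), 0) then -2 else 0

/-- Since |exp w|² = exp(2 Re w) and Re(x + iy)² = x² - y², real and imaginary parts of an entry
receive opposite quadratic tilts. -/
theorem norm_exp_sq_eq_tiltWeight (B : Matrix (Fin (m + 1)) (Fin (m + 1)) ℂ) :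
    ‖Complex.exp (-B 0 0 + (∑ k, ∑ l, (logCoeff m k l : ℂ) * B k l ^ 2) / 2)‖ ^ 2
      = tiltWeight (quadCoeff m) (linCoeff m) (realCoord B) := by
  rw [Complex.norm_exp, ← Real.exp_nat_mul, tiltWeight, ← Real.exp_sum]
  congr 1
  rw [Finset.sum_add_distrib]
  have h1 : ∑ p, linCoeff m p * realCoord B p = -2 * (B 0 0).re := by
    rw [Finset.sum_eq_single ((0, 0), 0) (fun p _ hp => by simp [linCoeff, hp]) (by simp)]
    simp [linCoeff, realCoord, reIm]
  have h2 : ∑ p, quadCoeff m p * realCoord B p ^ 2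
      = (∑ k, ∑ l, (logCoeff m k l : ℂ) * B k l ^ 2).re := by
    rw [Fintype.sum_prod_type, Fintype.sum_prod_type, Complex.re_sum]
    refine Finset.sum_congr rfl fun k _ => ?_
    rw [Complex.re_sum]
    refine Finset.sum_congr rfl fun l _ => ?_
    rw [Fin.sum_univ_two, Complex.re_ofReal_mul]
    simp [quadCoeff, realCoord, reIm, pow_two, Complex.mul_re]
    ring
  rw [h1, h2]
  simp
  ring

end Conjugation

/-! ### Scalar estimates -/

theorem one_sub_le_exp_neg_sub {y : ℝ} (h0 : 0 ≤ y) (h1 : y < 1) :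
    1 - y ≤ Real.exp (-y - y ^ 2 / 2) := by
  have h := Real.hasSum_pow_div_log_of_abs_lt_one (x := y) (by rwa [abs_of_nonneg h0])
  have h2 := sum_le_hasSum (Finset.range 2) (fun i _ => by positivity) h
  simp only [Finset.sum_range_succ, Finset.sum_range_zero] at h2
  rw [← Real.exp_log (show 0 < 1 - y by linarith)]
  refine Real.exp_le_exp.2 ?_
  norm_num at h2
  linarith

/-- Needed only for n = 1, where the gain t²/2 of log(1 + t) over t replaces part of the
second-order balance. -/
theorem one_add_le_exp_cubic {t : ℝ} (h0 : 0 ≤ t) (h1 : t ≤ 1) :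
    1 + t ≤ Real.exp (t - t ^ 2 / 2 + t ^ 3) := by
  have hx : 0 ≤ t - t ^ 2 / 2 + t ^ 3 := by nlinarith [pow_nonneg h0 3]
  refine le_trans ?_ (Real.quadratic_le_exp_of_nonneg hx)
  nlinarith [pow_nonneg h0 3, pow_nonneg h0 4, pow_nonneg h0 5, pow_nonneg h0 6,
    mul_nonneg (pow_nonneg h0 3) (sub_nonneg.2 h1)]

theorem inv_sqrt_one_sub_le_exp {x : ℝ} (h0 : 0 ≤ x) (h1 : x ≤ 1 / 4) :
    (√(1 - x))⁻¹ ≤ Real.exp ((x + x ^ 2) / 2) := by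
  have hpos : 0 < 1 - x := by linarith
  have h : 1 ≤ (1 - x) * Real.exp (x + x ^ 2) := by
    have := Real.quadratic_le_exp_of_nonneg (show 0 ≤ x + x ^ 2 by positivity)
    have h2 : 1 ≤ (1 - x) * (1 + (x + x ^ 2) + (x + x ^ 2) ^ 2 / 2) := by
      nlinarith [pow_nonneg h0 2, pow_nonneg h0 3, pow_nonneg h0 4,
        mul_nonneg (pow_nonneg h0 2) (sub_nonneg.2 h1), mul_nonneg (pow_nonneg h0 3) (sub_nonneg.2 h1),
        mul_nonneg (pow_nonneg h0 4) (sub_nonneg.2 h1)]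
    nlinarith
  rw [inv_le_iff_one_le_mul₀ (Real.sqrt_pos.2 hpos),
    show Real.exp ((x + x ^ 2) / 2) = √(Real.exp (x + x ^ 2)) from Real.exp_half _,
    ← Real.sqrt_mul (Real.exp_pos _).le, Real.one_le_sqrt]
  linarith

/-- The circular part of the variance of the entries under the reweighted law. -/
noncomputable def circVar (m : ℕ) (a : ℝ) : ℝ := (m + 1) * a / (1 - (a / m) ^ 2)

/-- The additional circular variance of row and column sums under the reweighted law. -/
noncomputable def excessVar (m : ℕ) (a : ℝ) : ℝ := (m + 1) * a / (1 - a ^ 2) - circVar m a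

/-- Minus the pseudo-covariance of entries in distinct rows and columns. -/
noncomputable def pseudoVar (m : ℕ) (a : ℝ) : ℝ :=
  (a ^ 2 / (1 - a ^ 2) + a * (a / m) / (1 - (a / m) ^ 2)) / (m + 1)

/-- The mean of the entries of `J + A` under the reweighted law. -/
noncomputable def shiftedMean (a : ℝ) : ℝ := 1 - a / (1 - a)

section Estimates

variable {m : ℕ} {a : ℝ}

theorem div_nat_bounds (h0 : 0 ≤ a) : 0 ≤ a / m ∧ a / m ≤ a := by
  refine ⟨by positivity, ?_⟩
  rcases Nat.eq_zero_or_pos m with rfl | hm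
  · simpa using h0
  · exact div_le_self h0 (by exact_mod_cast hm)

theorem inv_one_sub_sq_bounds {b : ℝ} (h0 : 0 ≤ b) (h1 : b ≤ 1 / 100) :
    1 ≤ 1 / (1 - b ^ 2) ∧ 1 / (1 - b ^ 2) ≤ 1 + 2 * b ^ 2 := by
  have hb : b ^ 2 ≤ 1 / 100 := by nlinarith
  have hpos : 0 < 1 - b ^ 2 := by linarith
  constructor
  · rw [le_div_iff₀ hpos]; nlinarith
  · rw [div_le_iff₀ hpos]; nlinarith [mul_nonneg (sq_nonneg b) (sub_nonneg.2 hb)]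

theorem circVar_bounds (h0 : 0 ≤ a) (h1 : a ≤ 1 / 100) :
    (m + 1) * a ≤ circVar m a ∧ circVar m a ≤ (m + 1) * a * (1 + 2 * a ^ 2) := by
  obtain ⟨hb0, hb1⟩ := div_nat_bounds (m := m) h0
  obtain ⟨h2, h3⟩ := inv_one_sub_sq_bounds hb0 (hb1.trans h1)
  have hn : 0 ≤ (m + 1) * a := by positivity
  rw [circVar, ← mul_one_div]
  constructor
  · exact le_mul_of_one_le_right hn h2
  · refine mul_le_mul_of_nonneg_left (h3.trans ?_) hn
    nlinarith

theorem excessVar_bounds (h0 : 0 ≤ a) (h1 : a ≤ 1 / 100) :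
    0 ≤ excessVar m a ∧ excessVar m a ≤ (m + 1) * a * (2 * a ^ 2) := by
  obtain ⟨hb0, hb1⟩ := div_nat_bounds (m := m) h0
  have hn : 0 ≤ (m + 1) * a := by positivity
  constructor
  · rw [excessVar, circVar, sub_nonneg]
    refine div_le_div_of_nonneg_left hn (by nlinarith) (by nlinarith)
  · have h2 := (circVar_bounds (m := m) h0 h1).1
    have h3 := mul_le_mul_of_nonneg_left (inv_one_sub_sq_bounds h0 h1).2 hn
    rw [excessVar, ← mul_one_div]
    linarith

theorem pseudoVar_nonneg (h0 : 0 ≤ a) (h1 : a ≤ 1 / 100) : 0 ≤ pseudoVar m a := by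
  obtain ⟨hb0, hb1⟩ := div_nat_bounds (m := m) h0
  have : 0 ≤ 1 - a ^ 2 := by nlinarith
  have : 0 ≤ 1 - (a / m) ^ 2 := by nlinarith
  unfold pseudoVar
  positivity

theorem pseudoVar_mul_le (h0 : 0 ≤ a) (h1 : a ≤ 1 / 100) :
    pseudoVar m a * (m + 1 : ℕ) ≤ 3 * a ^ 2 := by
  obtain ⟨hb0, hb1⟩ := div_nat_bounds (m := m) h0
  have h2 := (inv_one_sub_sq_bounds h0 h1).2
  have h3 := (inv_one_sub_sq_bounds hb0 (hb1.trans h1)).2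
  have e : pseudoVar m a * (m + 1 : ℕ)
      = a ^ 2 * (1 / (1 - a ^ 2)) + a * (a / m) * (1 / (1 - (a / m) ^ 2)) := by
    rw [pseudoVar]; push_cast
    field_simp
  rw [e]
  have hA : 1 / (1 - a ^ 2) ≤ 3 / 2 := h2.trans (by nlinarith)
  have hB : 1 / (1 - (a / m) ^ 2) ≤ 3 / 2 := h3.trans (by nlinarith)
  have h4 : a * (a / m) ≤ a ^ 2 := by nlinarith
  have h5 := mul_le_mul_of_nonneg_left hA (sq_nonneg a)
  have h6 := mul_le_mul_of_nonneg_left hB (mul_nonneg h0 hb0)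
  linarith

/-- The leading terms are m a² from the first summand of the pseudo-covariance and a² from the
second, which together give exactly (m+1)a². For m = 0 the right side vanishes, hence the
hypothesis. -/
theorem le_pseudoVar_mul (hm : 0 < m) (h0 : 0 ≤ a) (h1 : a ≤ 1 / 100) :
    (m + 1) * a ^ 2 ≤ pseudoVar m a * ((m + 1 : ℕ) * ((m + 1 : ℕ) - 1)) := by
  obtain ⟨hb0, hb1⟩ := div_nat_bounds (m := m) h0
  have h2 := (inv_one_sub_sq_bounds h0 h1).1
  have h3 := (inv_one_sub_sq_bounds hb0 (hb1.trans h1)).1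
  have hm' : (0 : ℝ) < m := by exact_mod_cast hm
  have e : pseudoVar m a * ((m + 1 : ℕ) * ((m + 1 : ℕ) - 1))
      = m * (a ^ 2 * (1 / (1 - a ^ 2))) + m * (a * (a / m)) * (1 / (1 - (a / m) ^ 2)) := by
    rw [pseudoVar, ← mul_one_div (a ^ 2), ← mul_one_div (a * (a / m))]; push_cast
    generalize 1 / (1 - a ^ 2) = x
    generalize 1 / (1 - (a / m) ^ 2) = w
    field_simp
    ring
  rw [e]
  have h4 : m * (a * (a / m)) = a ^ 2 := by field_simp
  rw [h4]
  have h5 := mul_le_mul_of_nonneg_left h2 (mul_nonneg hm'.le (sq_nonneg a))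
  have h6 := mul_le_mul_of_nonneg_left h3 (sq_nonneg a)
  nlinarith

theorem shiftedMean_bounds (h0 : 0 ≤ a) (h1 : a ≤ 1 / 100) :
    9 / 10 ≤ shiftedMean a ∧ shiftedMean a ≤ 1 := by
  have hpos : 0 < 1 - a := by linarith
  have : a / (1 - a) ≤ 1 / 10 := by rw [div_le_iff₀ hpos]; linarith
  have : 0 ≤ a / (1 - a) := by positivity
  unfold shiftedMean
  constructor <;> linarith

/-- This is q²: the exponential is 1 + O(a²) and 1/μ = 1 + a + O(a²). The coefficient 2 of a enters
the second-order cancellation and must be sharp; 30 need not be. -/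
theorem exp_pseudoVar_div_sq_le (h0 : 0 ≤ a) (h1 : a ≤ 1 / 100) :
    (Real.exp (pseudoVar m a * (m + 1 : ℕ)) / shiftedMean a) ^ 2 ≤ 1 + 2 * a + 30 * a ^ 2 := by
  have ha2 : a ^ 2 ≤ 1 / 10000 := by nlinarith
  have hpos : 0 < 1 - a := by linarith
  have hpos2 : 0 < 1 - 2 * a := by linarith
  have h2 : Real.exp (pseudoVar m a * (m + 1 : ℕ)) ≤ 1 + 4 * a ^ 2 := by
    refine (Real.exp_le_exp.2 (pseudoVar_mul_le h0 h1)).trans ?_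
    have := Real.exp_bound_div_one_sub_of_interval (x := 3 * a ^ 2) (by positivity) (by linarith)
    refine this.trans ?_
    rw [div_le_iff₀ (by linarith)]
    nlinarith [sq_nonneg a, mul_nonneg (sq_nonneg a) (sub_nonneg.2 ha2)]
  have h3 : (shiftedMean a)⁻¹ ≤ 1 + a + 3 * a ^ 2 := by
    have e : shiftedMean a = (1 - 2 * a) / (1 - a) := by
      rw [shiftedMean]; field_simp; ring
    rw [e, inv_div, div_le_iff₀ hpos2]
    nlinarith [mul_nonneg (sq_nonneg a) (sub_nonneg.2 h1)]
  have hμ := (shiftedMean_bounds h0 h1).1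
  have h4 : Real.exp (pseudoVar m a * (m + 1 : ℕ)) / shiftedMean a ≤ 1 + a + 8 * a ^ 2 := by
    rw [div_eq_mul_inv]
    calc _ ≤ (1 + 4 * a ^ 2) * (1 + a + 3 * a ^ 2) := by
          refine mul_le_mul h2 h3 (inv_nonneg.2 (by linarith)) (by positivity)
      _ ≤ _ := by nlinarith [mul_nonneg (sq_nonneg a) (sub_nonneg.2 h1),
                    mul_nonneg (sq_nonneg a) (sub_nonneg.2 ha2), sq_nonneg a]
  have h5 : 0 ≤ Real.exp (pseudoVar m a * (m + 1 : ℕ)) / shiftedMean a :=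
    div_nonneg (Real.exp_pos _).le (by linarith)
  calc _ ≤ (1 + a + 8 * a ^ 2) ^ 2 := pow_le_pow_left₀ h5 h4 2
    _ ≤ _ := by nlinarith [mul_nonneg (sq_nonneg a) (sub_nonneg.2 h1),
                    mul_nonneg (sq_nonneg a) (sub_nonneg.2 ha2), sq_nonneg a]

/-- Second-order balance for n = 1, in units of a²: 1 (linear tilt) + 1/2 (normalisation) - 3 (mean)
+ 2 - 1/2 (one coincidence, through log(1 + t)) = 0. -/
theorem exponent_le_of_size_one {y q d : ℝ} (h0 : 0 ≤ a) (h1 : a ≤ 1 / 100) (hy : a + a ^ 2 ≤ y)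
    (hq1 : 1 ≤ q ^ 2) (hq2 : q ^ 2 ≤ 1 + 2 * a + 30 * a ^ 2) (hd : d ≤ 12 * a ^ 3) :
    y + (a ^ 2 + (a ^ 2) ^ 2) / 2 + 2 * (-y - y ^ 2 / 2)
      + (d + (q ^ 2 * a - (q ^ 2 * a) ^ 2 / 2 + (q ^ 2 * a) ^ 3)) ≤ 50 * a ^ 3 := by
  have ha3 : 0 ≤ a ^ 3 := pow_nonneg h0 3
  have ha4 : a ^ 4 ≤ 1 / 100 * a ^ 3 := by nlinarith
  have hy2 : a ^ 2 ≤ y ^ 2 := pow_le_pow_left₀ h0 (by nlinarith) 2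
  have ht : q ^ 2 * a ≤ a + 2 * a ^ 2 + 30 * a ^ 3 := by
    have := mul_le_mul_of_nonneg_right hq2 h0
    linarith
  have htl : a ≤ q ^ 2 * a := le_mul_of_one_le_left h0 hq1
  have htsq : a ^ 2 ≤ (q ^ 2 * a) ^ 2 := pow_le_pow_left₀ h0 htl 2
  have ht3 : (q ^ 2 * a) ^ 3 ≤ 2 * a ^ 3 := by
    have h11 : q ^ 2 ≤ 11 / 10 := by nlinarith
    have h12 : (q ^ 2) ^ 3 ≤ (11 / 10) ^ 3 := pow_le_pow_left₀ (sq_nonneg q) h11 3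
    rw [mul_pow]
    exact mul_le_mul_of_nonneg_right (h12.trans (by norm_num)) ha3
  generalize q ^ 2 * a = t at *
  linarith

/-- Second-order balance for n ≥ 2, in units of na²: 1 (linear tilt) + 1 (normalisations) - 3 (mean)
- 1 (pseudo-covariance p) + 2 (coincidences t) = 0. The cubic terms 12 and 34 and the quartic
remainder fit into 50. -/
theorem exponent_le_of_size_ge_two {n y d t p B : ℝ} (h0 : 0 ≤ a) (h1 : a ≤ 1 / 100)
    (hy : a + a ^ 2 ≤ y) (hn : 0 ≤ n) (hB : B ≤ (a ^ 2 + (a ^ 2) ^ 2) / 2) (hp : n * a ^ 2 ≤ p)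
    (hd : d ≤ 12 * (n * a ^ 3)) (ht : t ≤ n * (a + 2 * a ^ 2 + 34 * a ^ 3)) :
    n * y + ((2 * n - 1) * ((a ^ 2 + (a ^ 2) ^ 2) / 2) + B) + (2 * n * (-y - y ^ 2 / 2) - p)
      + (d + t) ≤ 50 * (n * a ^ 3) := by
  have ha3 : 0 ≤ a ^ 3 := pow_nonneg h0 3
  have ha4 : a ^ 4 ≤ 1 / 100 * a ^ 3 := by nlinarith
  have hy2 : a ^ 2 ≤ y ^ 2 := pow_le_pow_left₀ h0 (by nlinarith) 2
  have hyy : n * (a + 2 * a ^ 2) ≤ n * (y + y ^ 2) :=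
    mul_le_mul_of_nonneg_left (by linarith) hn
  have h44 : n * a ^ 4 ≤ n * (1 / 100 * a ^ 3) := mul_le_mul_of_nonneg_left ha4 hn
  have h33 : 0 ≤ n * a ^ 3 := by positivity
  linarith

/-- The m² coordinates off the first row and column carry the tilt a/m, so together they cost no
more than one coordinate pair with tilt a. -/
theorem sq_mul_div_sq_le (h0 : 0 ≤ a) (hm : 0 < m) :
    (m : ℝ) ^ 2 * (((a / m) ^ 2 + ((a / m) ^ 2) ^ 2) / 2) ≤ (a ^ 2 + (a ^ 2) ^ 2) / 2 := by
  have hm' : (m : ℝ) ≠ 0 := by exact_mod_cast hm.ne'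
  have e : (m : ℝ) ^ 2 * (((a / m) ^ 2 + ((a / m) ^ 2) ^ 2) / 2)
      = (a ^ 2 + a ^ 2 * (a / m) ^ 2) / 2 := by
    field_simp
  rw [e]
  have := pow_le_pow_left₀ (div_nat_bounds (m := m) h0).1 (div_nat_bounds (m := m) h0).2 2
  have := mul_le_mul_of_nonneg_left this (sq_nonneg a)
  linarith

theorem mul_circVar_le (h0 : 0 ≤ a) (h1 : a ≤ 1 / 100) {r : ℝ}
    (hr : r ≤ 1 + 2 * a + 30 * a ^ 2) :
    r * circVar m a ≤ (m + 1) * (a + 2 * a ^ 2 + 34 * a ^ 3) := by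
  obtain ⟨hv1, hv2⟩ := circVar_bounds (m := m) h0 h1
  have hn : (0 : ℝ) ≤ m + 1 := by positivity
  refine (mul_le_mul hr hv2 (le_trans (by positivity) hv1) (by positivity)).trans ?_
  rw [show (1 + 2 * a + 30 * a ^ 2) * ((m + 1) * a * (1 + 2 * a ^ 2))
    = (m + 1) * (a * (1 + 2 * a + 30 * a ^ 2) * (1 + 2 * a ^ 2)) by ring]
  refine mul_le_mul_of_nonneg_left ?_ hn
  have ha3 : 0 ≤ a ^ 3 := pow_nonneg h0 3
  have ha4 : a ^ 4 ≤ 1 / 100 * a ^ 3 := by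
    have := mul_le_mul_of_nonneg_right h1 ha3
    linarith
  have ha5 : a ^ 5 ≤ 1 / 100 * a ^ 3 := by
    have h2 : a ^ 2 ≤ 1 / 100 := by nlinarith
    have := mul_le_mul_of_nonneg_right h2 ha3
    linarith
  linarith

/-- All contributions of order one and two in `a` cancel. -/
theorem second_moment_estimate (h0 : 0 ≤ a) (h1 : a ≤ 1 / 100) {q F : ℝ}
    (hq : q = Real.exp (pseudoVar m a * (m + 1 : ℕ)) / shiftedMean a)
    (hF : F ≤ Real.exp (q ^ 2 * circVar m a)) (hF0 : m = 0 → F ≤ 1 + q ^ 2 * circVar m a) :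
    Real.exp ((m + 1) * (a / (1 - a))) * Real.exp ((2 * m + 1) * ((a ^ 2 + (a ^ 2) ^ 2) / 2)
        + m ^ 2 * (((a / m) ^ 2 + ((a / m) ^ 2) ^ 2) / 2))
      * (shiftedMean a ^ (m + 1)
          * Real.exp (-(pseudoVar m a * ((m + 1 : ℕ) * ((m + 1 : ℕ) - 1)) / 2))) ^ 2
      * (Real.exp (3 * q ^ 2 * excessVar m a) * F)
      ≤ Real.exp (50 * ((m + 1) * a ^ 3)) := by
  have hpos : 0 < 1 - a := by linarith
  set y := a / (1 - a) with hy
  have hy0 : 0 ≤ y := by positivity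
  have hyl : a + a ^ 2 ≤ y := by
    rw [hy, le_div_iff₀ hpos]; nlinarith
  have hy1 : y < 1 := by rw [hy, div_lt_one hpos]; linarith
  have hq2 : q ^ 2 ≤ 1 + 2 * a + 30 * a ^ 2 := by
    rw [hq]; exact exp_pseudoVar_div_sq_le h0 h1
  have hqsq : 0 ≤ q ^ 2 := sq_nonneg q
  have hqle : q ^ 2 ≤ 2 := by nlinarith
  obtain ⟨hv1, hv2⟩ := circVar_bounds (m := m) h0 h1
  obtain ⟨hd1, hd2⟩ := excessVar_bounds (m := m) h0 h1
  have hn : (0 : ℝ) < m + 1 := by positivity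
  have hμ : (shiftedMean a ^ (m + 1)
          * Real.exp (-(pseudoVar m a * ((m + 1 : ℕ) * ((m + 1 : ℕ) - 1)) / 2))) ^ 2
      ≤ Real.exp (2 * (m + 1) * (-y - y ^ 2 / 2)
          - pseudoVar m a * ((m + 1 : ℕ) * ((m + 1 : ℕ) - 1))) := by
    have hs := (shiftedMean_bounds h0 h1).1
    have h2 : shiftedMean a ^ (m + 1) ≤ Real.exp ((m + 1 : ℕ) * (-y - y ^ 2 / 2)) := by
      rw [Real.exp_nat_mul]
      exact pow_le_pow_left₀ (by linarith) (one_sub_le_exp_neg_sub hy0 hy1) _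
    calc _ ≤ (Real.exp ((m + 1 : ℕ) * (-y - y ^ 2 / 2))
          * Real.exp (-(pseudoVar m a * ((m + 1 : ℕ) * ((m + 1 : ℕ) - 1)) / 2))) ^ 2 :=
          pow_le_pow_left₀ (by positivity) (mul_le_mul_of_nonneg_right h2 (Real.exp_pos _).le) 2
      _ = _ := by
          rw [← Real.exp_add, ← Real.exp_nat_mul]
          congr 1
          push_cast
          ring
  -- The bound for F is the only choice: for n = 1 the exponential bound would lose t²/2, an error
  -- of order a², so the exact 1 + t is used.
  obtain ⟨f, hFf, hf⟩ : ∃ f, F ≤ Real.exp f ∧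
      (m + 1) * y + ((2 * m + 1) * ((a ^ 2 + (a ^ 2) ^ 2) / 2)
        + m ^ 2 * (((a / m) ^ 2 + ((a / m) ^ 2) ^ 2) / 2))
        + (2 * (m + 1) * (-y - y ^ 2 / 2)
          - pseudoVar m a * ((m + 1 : ℕ) * ((m + 1 : ℕ) - 1)))
        + (3 * q ^ 2 * excessVar m a + f) ≤ 50 * ((m + 1) * a ^ 3) := by
    have hdq : 3 * q ^ 2 * excessVar m a ≤ 12 * ((m + 1) * a ^ 3) := by
      have := mul_le_mul hqle hd2 hd1 (by norm_num)
      linarith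
    rcases Nat.eq_zero_or_pos m with rfl | hm
    · have hq1 : 1 ≤ q ^ 2 := by
        have hs := shiftedMean_bounds h0 h1
        have he : 1 ≤ Real.exp (pseudoVar 0 a * (0 + 1 : ℕ)) :=
          Real.one_le_exp (mul_nonneg (pseudoVar_nonneg h0 h1) (Nat.cast_nonneg _))
        have : 1 ≤ q := by
          rw [hq, le_div_iff₀ (by linarith)]
          linarith
        nlinarith
      have hc : circVar 0 a = a := by simp [circVar]
      rw [hc] at hF0
      have ht0 : 0 ≤ q ^ 2 * a := by positivity
      have ht1 : q ^ 2 * a ≤ 1 := by nlinarith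
      refine ⟨_, (hF0 rfl).trans (one_add_le_exp_cubic ht0 ht1), ?_⟩
      have e0 : pseudoVar 0 a * ((0 + 1 : ℕ) * ((0 + 1 : ℕ) - 1)) = 0 := by simp
      rw [e0]
      simp only [Nat.cast_zero, ne_eq, OfNat.ofNat_ne_zero, not_false_eq_true, zero_pow, zero_mul,
        mul_zero, zero_add, add_zero, one_mul, mul_one, sub_zero] at hdq ⊢
      exact exponent_le_of_size_one h0 h1 hyl hq1 hq2 hdq
    · refine ⟨_, hF, ?_⟩
      have := exponent_le_of_size_ge_two h0 h1 hyl hn.le (sq_mul_div_sq_le h0 hm)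
        (le_pseudoVar_mul hm h0 h1) hdq (mul_circVar_le h0 h1 hq2)
      rwa [show (2 * ((m : ℝ) + 1) - 1) = 2 * m + 1 by ring] at this
  calc _ ≤ Real.exp ((m + 1) * y) * Real.exp ((2 * m + 1) * ((a ^ 2 + (a ^ 2) ^ 2) / 2)
        + m ^ 2 * (((a / m) ^ 2 + ((a / m) ^ 2) ^ 2) / 2))
      * (shiftedMean a ^ (m + 1)
          * Real.exp (-(pseudoVar m a * ((m + 1 : ℕ) * ((m + 1 : ℕ) - 1)) / 2))) ^ 2
      * (Real.exp (3 * q ^ 2 * excessVar m a) * Real.exp f) := by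
        gcongr
    _ ≤ Real.exp ((m + 1) * y) * Real.exp ((2 * m + 1) * ((a ^ 2 + (a ^ 2) ^ 2) / 2)
        + m ^ 2 * (((a / m) ^ 2 + ((a / m) ^ 2) ^ 2) / 2))
      * Real.exp (2 * (m + 1) * (-y - y ^ 2 / 2)
          - pseudoVar m a * ((m + 1 : ℕ) * ((m + 1 : ℕ) - 1)))
      * (Real.exp (3 * q ^ 2 * excessVar m a) * Real.exp f) := by
        gcongr
    _ ≤ _ := by
        rw [← Real.exp_add, ← Real.exp_add, ← Real.exp_add, ← Real.exp_add]
        exact Real.exp_le_exp.2 hf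

end Estimates

/-! ### Mean and covariances of the entries under the tilted law -/

section Covariance

variable {m : ℕ} {a : ℝ} {s : ℝ≥0}

theorem two_mul_quadCoeff (hs : 2 * (s : ℝ) = (m + 1) * a)
    (p : (Fin (m + 1) × Fin (m + 1)) × Fin 2) :
    2 * s * quadCoeff m p = if p.2 = 0 then (if p.1.1 = 0 ∨ p.1.2 = 0 then a else -(a / m))
      else (if p.1.1 = 0 ∨ p.1.2 = 0 then -a else a / m) := by
  have hn : (m + 1 : ℝ) ≠ 0 := by positivity
  have h1 : (m + 1) * a * (1 / (m + 1)) = a := by field_simp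
  have h2 : (m + 1) * a * (1 / ((m + 1) * m)) = a / m := by
    rw [one_div, mul_inv]; field_simp
  rw [quadCoeff, logCoeff, hs]
  split_ifs <;> simp only [mul_neg, neg_neg, h1, h2]

theorem two_mul_quadCoeff_lt (h0 : 0 ≤ a) (h1 : a ≤ 1 / 100) (hs : 2 * (s : ℝ) = (m + 1) * a)
    (p : (Fin (m + 1) × Fin (m + 1)) × Fin 2) : 2 * s * quadCoeff m p < 1 := by
  obtain ⟨hb0, hb1⟩ := div_nat_bounds (m := m) h0
  rw [two_mul_quadCoeff hs]
  split_ifs <;> linarith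

theorem tiltVar_quadCoeff (h0 : 0 ≤ a) (h1 : a ≤ 1 / 100) (hs : 2 * (s : ℝ) = (m + 1) * a)
    (p : (Fin (m + 1) × Fin (m + 1)) × Fin 2) :
    (tiltVar s (quadCoeff m p) : ℝ)
      = if p.2 = 0 then (if p.1.1 = 0 ∨ p.1.2 = 0 then s / (1 - a) else s / (1 + a / m))
        else (if p.1.1 = 0 ∨ p.1.2 = 0 then s / (1 + a) else s / (1 - a / m)) := by
  rw [coe_tiltVar (two_mul_quadCoeff_lt h0 h1 hs p), two_mul_quadCoeff hs]
  split_ifs <;> simp only [sub_neg_eq_add]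

theorem sum_sum_ite_zero (x y : ℝ) :
    ∑ k : Fin (m + 1), ∑ l : Fin (m + 1), (if k = 0 ∨ l = 0 then x else y)
      = (2 * m + 1) * x + m ^ 2 * y := by
  simp only [Fin.sum_univ_succ, Fin.succ_ne_zero, true_or, false_or, if_true, if_false,
    Finset.sum_const, Finset.card_univ, Fintype.card_fin, nsmul_eq_mul]
  ring

/-- Only the real part of B₀₀ has a linear tilt, which gives the first exponential. The
normalisations are estimated in pairs. -/
theorem prod_tiltMass_le (h0 : 0 ≤ a) (h1 : a ≤ 1 / 100) (hs : 2 * (s : ℝ) = (m + 1) * a) :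
    ∏ p, tiltMass s (quadCoeff m p) (linCoeff m p)
      ≤ Real.exp ((m + 1) * (a / (1 - a))) * Real.exp ((2 * m + 1) * ((a ^ 2 + (a ^ 2) ^ 2) / 2)
        + m ^ 2 * (((a / m) ^ 2 + ((a / m) ^ 2) ^ 2) / 2)) := by
  obtain ⟨hb0, hb1⟩ := div_nat_bounds (m := m) h0
  simp only [tiltMass]
  rw [Finset.prod_mul_distrib, ← Real.exp_sum, mul_comm]
  have e1 : ∑ p, linCoeff m p ^ 2 * tiltVar s (quadCoeff m p) / 2 = (m + 1) * (a / (1 - a)) := by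
    rw [Finset.sum_eq_single ((0, 0), 0) (fun p _ hp => by simp [linCoeff, hp]) (by simp),
      tiltVar_quadCoeff h0 h1 hs]
    simp only [linCoeff, true_or, if_true]
    rw [show (-2 : ℝ) ^ 2 * (s / (1 - a)) / 2 = 2 * s / (1 - a) by ring, hs, mul_div_assoc]
  rw [e1]
  refine mul_le_mul_of_nonneg_left ?_ (Real.exp_pos _).le
  rw [← sum_sum_ite_zero, Real.exp_sum, Fintype.prod_prod_type, Fintype.prod_prod_type]
  refine Finset.prod_le_prod (fun k _ => by positivity) fun k _ => ?_
  rw [Real.exp_sum]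
  refine Finset.prod_le_prod (fun l _ => by positivity) fun l _ => ?_
  -- Opposite tilts of real and imaginary parts combine to (1 - x)(1 + x) = 1 - x², so no
  -- first-order term survives.
  have key : ∀ x : ℝ, 0 ≤ x → x ≤ 1 / 100 →
      (√(1 - x))⁻¹ * (√(1 + x))⁻¹ ≤ Real.exp ((x ^ 2 + (x ^ 2) ^ 2) / 2) := by
    intro x hx0 hx1
    rw [← mul_inv, ← Real.sqrt_mul (by linarith), show (1 - x) * (1 + x) = 1 - x ^ 2 by ring]
    exact inv_sqrt_one_sub_le_exp (sq_nonneg x) (by nlinarith)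
  rw [Fin.prod_univ_two, two_mul_quadCoeff hs, two_mul_quadCoeff hs]
  simp only [if_true, one_ne_zero, if_false]
  split_ifs
  · rw [sub_neg_eq_add]; exact key a h0 h1
  · rw [sub_neg_eq_add, mul_comm]; exact key _ hb0 (hb1.trans h1)

variable {O : Matrix (Fin (m + 1)) (Fin (m + 1)) ℝ}

/-- The variance is y everywhere plus x - y on the first row and column. The constant part gives
Kronecker deltas by orthogonality of the columns of O, and the rest is explicit because the first
row of O is constant. -/
theorem sum_sum_orthogonal_ite (hO : O * O.transpose = 1) (hrow : ∀ j, O 0 j = (√(m + 1))⁻¹)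
    (x y : ℝ) (i j i' j' : Fin (m + 1)) :
    ∑ k, ∑ l, O k i * O l j * (O k i' * O l j') * (if k = 0 ∨ l = 0 then x else y)
      = (if i = i' then 1 else 0) * (if j = j' then 1 else 0) * y
        + (x - y) * (((if i = i' then 1 else 0) + (if j = j' then 1 else 0)) / (m + 1)
          - 1 / (m + 1) ^ 2) := by
  have hcol : ∀ i i', ∑ k, O k i * O k i' = if i = i' then 1 else 0 := fun i i' => by
    have := congrFun (congrFun (mul_eq_one_comm.1 hO : O.transpose * O = 1) i) i'
    simpa [Matrix.mul_apply, Matrix.one_apply] using this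
  have hz : ∀ i i', O 0 i * O 0 i' = 1 / (m + 1) := fun i i' => by
    rw [hrow, hrow, ← mul_inv, Real.mul_self_sqrt (by positivity), one_div]
  have h : ∀ k l, O k i * O l j * (O k i' * O l j') * (if k = 0 ∨ l = 0 then x else y)
      = y * ((O k i * O k i') * (O l j * O l j')) + (x - y) *
        ((if k = 0 then (O k i * O k i') * (O l j * O l j') else 0)
          + (if l = 0 then (O k i * O k i') * (O l j * O l j') else 0)
          - (if k = 0 then if l = 0 then (O k i * O k i') * (O l j * O l j') else 0 else 0)) := by
    intro k l
    by_cases hk : k = 0 <;> by_cases hl : l = 0 <;> simp [hk, hl] <;> ring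
  simp_rw [h, Finset.sum_add_distrib, ← Finset.mul_sum, Finset.sum_sub_distrib,
    Finset.sum_add_distrib]
  rw [← Finset.sum_mul, hcol, hcol]
  have e1 : ∑ k, ∑ l, (if k = 0 then (O k i * O k i') * (O l j * O l j') else 0)
      = (if j = j' then 1 else 0) / (m + 1) := by
    rw [Finset.sum_comm]
    simp only [Finset.sum_ite_eq', Finset.mem_univ, if_true]
    rw [← Finset.mul_sum, hcol, hz]
    ring
  have e2 : ∑ k, ∑ l, (if l = 0 then (O k i * O k i') * (O l j * O l j') else 0)
      = (if i = i' then 1 else 0) / (m + 1) := by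
    simp only [Finset.sum_ite_eq', Finset.mem_univ, if_true]
    rw [← Finset.sum_mul, hcol, hz]
    ring
  have e3 : ∑ k, ∑ l, (if k = 0 then if l = 0 then (O k i * O k i') * (O l j * O l j') else 0 else 0)
      = 1 / ((m : ℝ) + 1) ^ 2 := by
    rw [Finset.sum_comm]
    simp only [Finset.sum_ite_eq', Finset.mem_univ, if_true]
    rw [hz, hz, div_mul_div_comm, one_mul, pow_two]
  rw [e1, e2, e3]
  ring

/-- The coefficients of an entry of `A = Oᵀ B O` (for `u = i`) or of its conjugate (for `u = -i`)
in the real coordinates of `B`. -/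
noncomputable def entryCoeff (O : Matrix (Fin (m + 1)) (Fin (m + 1)) ℝ) (u : ℂ)
    (i j : Fin (m + 1)) (p : (Fin (m + 1) × Fin (m + 1)) × Fin 2) : ℂ :=
  (O p.1.1 i * O p.1.2 j : ℝ) * (if p.2 = 0 then 1 else u)

/-- The sign e is -1 for two factors of the same family, where real and imaginary variances
subtract, and +1 for a factor and a conjugate one, where they add. -/
theorem sum_entryCoeff_mul (hO : O * O.transpose = 1) (hrow : ∀ j, O 0 j = (√(m + 1))⁻¹)
    (h0 : 0 ≤ a) (h1 : a ≤ 1 / 100) (hs : 2 * (s : ℝ) = (m + 1) * a) {u u' : ℂ} {e : ℝ}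
    (hu : u * u' = e) (i j i' j' : Fin (m + 1)) :
    ∑ p, entryCoeff O u i j p * entryCoeff O u' i' j' p * ((tiltVar s (quadCoeff m p) : ℝ) : ℂ)
      = (((if i = i' then 1 else 0) * (if j = j' then 1 else 0)
            * (s / (1 + a / m) + e * (s / (1 - a / m)))
          + (s / (1 - a) + e * (s / (1 + a)) - (s / (1 + a / m) + e * (s / (1 - a / m))))
            * (((if i = i' then 1 else 0) + (if j = j' then 1 else 0)) / (m + 1)
              - 1 / (m + 1) ^ 2) : ℝ) : ℂ) := by
  rw [← sum_sum_orthogonal_ite hO hrow, Fintype.sum_prod_type, Fintype.sum_prod_type]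
  push_cast
  refine Finset.sum_congr rfl fun k _ => Finset.sum_congr rfl fun l _ => ?_
  rw [Fin.sum_univ_two, tiltVar_quadCoeff h0 h1 hs, tiltVar_quadCoeff h0 h1 hs]
  simp only [entryCoeff, if_true, one_ne_zero, if_false]
  split_ifs
  · push_cast
    rw [← hu]
    ring
  · push_cast
    rw [← hu]
    ring

/-- Distinct rows and columns make all deltas vanish, leaving a constant. Two factors along one
permutation always satisfy this, which is why Hermite numbers appear. -/
theorem sum_entryCoeff_holomorphic (hO : O * O.transpose = 1) (hrow : ∀ j, O 0 j = (√(m + 1))⁻¹)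
    (h0 : 0 ≤ a) (h1 : a ≤ 1 / 100) (hs : 2 * (s : ℝ) = (m + 1) * a) {u : ℂ}
    (hu : u * u = -1) {i j i' j' : Fin (m + 1)} (hi : i ≠ i') (hj : j ≠ j') :
    ∑ p, entryCoeff O u i j p * entryCoeff O u i' j' p * ((tiltVar s (quadCoeff m p) : ℝ) : ℂ)
      = -(pseudoVar m a : ℂ) := by
  obtain ⟨hb0, hb1⟩ := div_nat_bounds (m := m) h0
  rw [sum_entryCoeff_mul hO hrow h0 h1 hs (e := -1) (by rw [hu]; simp), if_neg hi, if_neg hj,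
    ← Complex.ofReal_neg]
  congr 1
  have hs' : (s : ℝ) = (m + 1) * a / 2 := by linarith
  generalize hβ : a / m = β at *
  have n1 : (1 - a) ≠ 0 := by linarith
  have n2 : (1 + a) ≠ 0 := by linarith
  have n3 : (1 - β) ≠ 0 := by linarith
  have n4 : (1 + β) ≠ 0 := by linarith
  have n5 : (1 - a ^ 2) ≠ 0 := by nlinarith
  have n6 : (1 - β ^ 2) ≠ 0 := by nlinarith
  have n7 : (m + 1 : ℝ) ≠ 0 := by positivity
  have r1 : (s : ℝ) / (1 - a) + -1 * (s / (1 + a)) = (m + 1) * (a ^ 2 / (1 - a ^ 2)) := by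
    rw [hs', show 1 - a ^ 2 = (1 - a) * (1 + a) by ring]; field_simp; ring
  have r2 : (s : ℝ) / (1 + β) + -1 * (s / (1 - β)) = -((m + 1) * (a * β / (1 - β ^ 2))) := by
    rw [hs', show 1 - β ^ 2 = (1 - β) * (1 + β) by ring]; field_simp; ring
  rw [pseudoVar, hβ, r1, r2]
  generalize a ^ 2 / (1 - a ^ 2) = x
  generalize a * β / (1 - β ^ 2) = y
  field_simp
  ring

theorem sum_entryCoeff_mixed (hO : O * O.transpose = 1) (hrow : ∀ j, O 0 j = (√(m + 1))⁻¹)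
    (h0 : 0 ≤ a) (h1 : a ≤ 1 / 100) (hs : 2 * (s : ℝ) = (m + 1) * a) (i j i' j' : Fin (m + 1)) :
    ∑ p, entryCoeff O Complex.I i j p * entryCoeff O (-Complex.I) i' j' p
        * ((tiltVar s (quadCoeff m p) : ℝ) : ℂ)
      = (((if i = i' then 1 else 0) * (if j = j' then 1 else 0) * circVar m a
          + excessVar m a * (((if i = i' then 1 else 0) + (if j = j' then 1 else 0)) / (m + 1)
              - 1 / (m + 1) ^ 2) : ℝ) : ℂ) := by
  obtain ⟨hb0, hb1⟩ := div_nat_bounds (m := m) h0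
  rw [sum_entryCoeff_mul hO hrow h0 h1 hs (e := 1) (by simp)]
  have hs' : (s : ℝ) = (m + 1) * a / 2 := by linarith
  have r1 : (s : ℝ) / (1 - a) + 1 * (s / (1 + a)) = (m + 1) * a / (1 - a ^ 2) := by
    have n1 : (1 - a) ≠ 0 := by linarith
    have n2 : (1 + a) ≠ 0 := by linarith
    rw [hs', show 1 - a ^ 2 = (1 - a) * (1 + a) by ring]; field_simp; ring
  have r2 : (s : ℝ) / (1 + a / m) + 1 * (s / (1 - a / m)) = circVar m a := by
    rw [circVar]
    generalize hβ : a / m = β at *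
    have n3 : (1 - β) ≠ 0 := by linarith
    have n4 : (1 + β) ≠ 0 := by linarith
    rw [hs', show 1 - β ^ 2 = (1 - β) * (1 + β) by ring]; field_simp; ring
  rw [r1, r2, excessVar]

/-- Only the real part of B₀₀ is shifted, by -2s/(1 - a), and the constant first row of O spreads
this evenly, as -a/(1 - a), over all entries. -/
theorem one_add_sum_entryCoeff_mean (hrow : ∀ j, O 0 j = (√(m + 1))⁻¹)
    (h0 : 0 ≤ a) (h1 : a ≤ 1 / 100) (hs : 2 * (s : ℝ) = (m + 1) * a) (u : ℂ)
    (i j : Fin (m + 1)) :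
    1 + ∑ p, entryCoeff O u i j p * ((linCoeff m p * tiltVar s (quadCoeff m p) : ℝ) : ℂ)
      = (shiftedMean a : ℂ) := by
  rw [Finset.sum_eq_single ((0, 0), 0) (fun p _ hp => by simp [linCoeff, hp]) (by simp),
    tiltVar_quadCoeff h0 h1 hs, entryCoeff, hrow, hrow, ← mul_inv,
    Real.mul_self_sqrt (by positivity)]
  simp only [linCoeff, true_or, if_true, mul_one]
  rw [← Complex.ofReal_mul, ← Complex.ofReal_one, ← Complex.ofReal_add]
  congr 1
  have hs' : (s : ℝ) = (m + 1) * a / 2 := by linarith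
  have n1 : (1 - a) ≠ 0 := by linarith
  rw [hs', shiftedMean]
  field_simp
  ring

/-- The product of the factors `1 + A (σ i) i`, `i ∈ S`, and the conjugates of the factors
`1 + A (τ j) j`, `j ∈ T`, as a polynomial in the real coordinates of `O A Oᵀ`. -/
noncomputable def pairProd (O : Matrix (Fin (m + 1)) (Fin (m + 1)) ℝ)
    (σ τ : Equiv.Perm (Fin (m + 1))) (S T : Finset (Fin (m + 1))) :
    MvPolynomial ((Fin (m + 1) × Fin (m + 1)) × Fin 2) ℂ :=
  (∏ i ∈ S, affineForm 1 (entryCoeff O Complex.I (σ i) i))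
    * ∏ j ∈ T, affineForm 1 (entryCoeff O (-Complex.I) (τ j) j)

/-- The coefficients of the two families of factors, indexed by a sum type. -/
noncomputable def pairCoeff (O : Matrix (Fin (m + 1)) (Fin (m + 1)) ℝ)
    (σ τ : Equiv.Perm (Fin (m + 1))) :
    Fin (m + 1) ⊕ Fin (m + 1) → (Fin (m + 1) × Fin (m + 1)) × Fin 2 → ℂ :=
  Sum.elim (fun i => entryCoeff O Complex.I (σ i) i) fun j => entryCoeff O (-Complex.I) (τ j) j

theorem pairProd_eq (σ τ : Equiv.Perm (Fin (m + 1))) (S T : Finset (Fin (m + 1))) :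
    pairProd O σ τ S T = ∏ k ∈ S.disjSum T, affineForm 1 (pairCoeff O σ τ k) := by
  rw [Finset.prod_disjSum]
  rfl

theorem tiltExpect_pairProd_insert_left (hO : O * O.transpose = 1)
    (hrow : ∀ j, O 0 j = (√(m + 1))⁻¹) (h0 : 0 ≤ a) (h1 : a ≤ 1 / 100)
    (hs : 2 * (s : ℝ) = (m + 1) * a) (σ τ : Equiv.Perm (Fin (m + 1))) {i : Fin (m + 1)}
    {S T : Finset (Fin (m + 1))} (hi : i ∉ S) :
    tiltExpect (linCoeff m) (two_mul_quadCoeff_lt h0 h1 hs) (pairProd O σ τ (insert i S) T)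
      = shiftedMean a
          * tiltExpect (linCoeff m) (two_mul_quadCoeff_lt h0 h1 hs) (pairProd O σ τ S T)
        - pseudoVar m a * ∑ l ∈ S, tiltExpect (linCoeff m) (two_mul_quadCoeff_lt h0 h1 hs)
            (pairProd O σ τ (S.erase l) T)
        + ∑ j ∈ T, (((if σ i = τ j then 1 else 0) * (if i = j then 1 else 0) * circVar m a
          + excessVar m a * (((if σ i = τ j then 1 else 0) + (if i = j then 1 else 0)) / (m + 1)
              - 1 / (m + 1) ^ 2) : ℝ) : ℂ)
          * tiltExpect (linCoeff m) (two_mul_quadCoeff_lt h0 h1 hs)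
              (pairProd O σ τ S (T.erase j)) := by
  have e1 : (insert i S).disjSum T = insert (Sum.inl i) (S.disjSum T) := by
    ext (x | x) <;> simp
  have e2 : ∀ l, (S.disjSum T).erase (Sum.inl l) = (S.erase l).disjSum T := fun l => by
    ext (x | x) <;> simp
  have e3 : ∀ j, (S.disjSum T).erase (Sum.inr j) = S.disjSum (T.erase j) := fun j => by
    ext (x | x) <;> simp
  simp only [pairProd_eq]
  rw [e1, tiltExpect_prod_insert _ _ (fun _ => 1) _ (by simpa using hi), Finset.sum_disjSum]
  simp only [e2, e3]
  rw [sub_eq_add_neg, add_assoc]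
  congr 1
  · congr 1
    exact one_add_sum_entryCoeff_mean hrow h0 h1 hs _ _ _
  congr 1
  · rw [Finset.mul_sum, ← Finset.sum_neg_distrib]
    refine Finset.sum_congr rfl fun l hl => ?_
    have hne : i ≠ l := fun e => hi (e ▸ hl)
    rw [← neg_mul]
    congr 1
    exact sum_entryCoeff_holomorphic hO hrow h0 h1 hs (by simp) (σ.injective.ne hne) hne
  · refine Finset.sum_congr rfl fun j _ => ?_
    congr 1
    exact sum_entryCoeff_mixed hO hrow h0 h1 hs _ _ _ _

theorem tiltExpect_pairProd_empty_insert (hO : O * O.transpose = 1)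
    (hrow : ∀ j, O 0 j = (√(m + 1))⁻¹) (h0 : 0 ≤ a) (h1 : a ≤ 1 / 100)
    (hs : 2 * (s : ℝ) = (m + 1) * a) (σ τ : Equiv.Perm (Fin (m + 1))) {j : Fin (m + 1)}
    {T : Finset (Fin (m + 1))} (hj : j ∉ T) :
    tiltExpect (linCoeff m) (two_mul_quadCoeff_lt h0 h1 hs) (pairProd O σ τ ∅ (insert j T))
      = shiftedMean a
          * tiltExpect (linCoeff m) (two_mul_quadCoeff_lt h0 h1 hs) (pairProd O σ τ ∅ T)
        - pseudoVar m a * ∑ l ∈ T, tiltExpect (linCoeff m) (two_mul_quadCoeff_lt h0 h1 hs)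
            (pairProd O σ τ ∅ (T.erase l)) := by
  simp only [pairProd, Finset.prod_empty, one_mul]
  rw [tiltExpect_prod_insert _ _ (fun _ => 1) _ hj, sub_eq_add_neg]
  congr 1
  · congr 1
    exact one_add_sum_entryCoeff_mean hrow h0 h1 hs _ _ _
  · rw [Finset.mul_sum, ← Finset.sum_neg_distrib]
    refine Finset.sum_congr rfl fun l hl => ?_
    have hne : j ≠ l := fun e => hj (e ▸ hl)
    rw [← neg_mul]
    congr 1
    exact sum_entryCoeff_holomorphic hO hrow h0 h1 hs (by simp) (τ.injective.ne hne) hne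

/-- The circular part survives only at j = i with σ i = τ i. The excess contributes 1/n for the
equal row, 1/n for the equal column and n terms of size 1/n², which makes 3/n. -/
theorem sum_norm_mixed_le (h0 : 0 ≤ a) (h1 : a ≤ 1 / 100) (σ τ : Equiv.Perm (Fin (m + 1)))
    (i : Fin (m + 1)) :
    ∑ j, ‖((((if σ i = τ j then 1 else 0) * (if i = j then 1 else 0) * circVar m a
          + excessVar m a * (((if σ i = τ j then 1 else 0) + (if i = j then 1 else 0)) / (m + 1)
              - 1 / (m + 1) ^ 2) : ℝ) : ℂ))‖
      ≤ (if σ i = τ i then circVar m a else 0) + 3 * excessVar m a / (m + 1) := by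
  have hv : 0 ≤ circVar m a := le_trans (by positivity) (circVar_bounds (m := m) h0 h1).1
  have hd := (excessVar_bounds (m := m) h0 h1).1
  have hn : (0 : ℝ) < m + 1 := by positivity
  have hle : ∀ j, ‖((((if σ i = τ j then 1 else 0) * (if i = j then 1 else 0) * circVar m a
          + excessVar m a * (((if σ i = τ j then 1 else 0) + (if i = j then 1 else 0)) / (m + 1)
              - 1 / (m + 1) ^ 2) : ℝ) : ℂ))‖
      ≤ (if i = j then (if σ i = τ i then circVar m a else 0) else 0)
        + (if j = τ.symm (σ i) then excessVar m a / (m + 1) else 0)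
        + (if i = j then excessVar m a / (m + 1) else 0)
        + excessVar m a / (m + 1) ^ 2 := by
    intro j
    have hiff : (j = τ.symm (σ i)) = (σ i = τ j) := by
      rw [Equiv.eq_symm_apply]; exact propext eq_comm
    rw [Complex.norm_real, Real.norm_eq_abs]
    simp only [hiff]
    have p1 : 0 ≤ excessVar m a / (m + 1) := by positivity
    have p2 : 0 ≤ excessVar m a / (m + 1) ^ 2 := by positivity
    have r0 : excessVar m a * (0 / (m + 1) - 1 / (m + 1) ^ 2) = -(excessVar m a / (m + 1) ^ 2) := by
      ring
    have r1 : excessVar m a * (1 / (m + 1) - 1 / (m + 1) ^ 2)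
        = excessVar m a / (m + 1) - excessVar m a / (m + 1) ^ 2 := by ring
    have r2 : excessVar m a * ((1 + 1) / (m + 1) - 1 / (m + 1) ^ 2)
        = 2 * (excessVar m a / (m + 1)) - excessVar m a / (m + 1) ^ 2 := by ring
    by_cases hij : i = j
    · subst hij
      by_cases hσ : σ i = τ i
      · simp only [hσ, if_true, one_mul]
        rw [r2, abs_le]
        constructor <;> linarith
      · simp only [hσ, if_true, if_false, zero_mul, zero_add]
        rw [r1, abs_le]
        constructor <;> linarith
    · by_cases hσ : σ i = τ j
      · simp only [hσ, hij, if_true, if_false, mul_zero, zero_mul, add_zero, zero_add]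
        rw [r1, abs_le]
        constructor <;> linarith
      · simp only [hσ, hij, if_false, zero_mul, zero_add, add_zero]
        rw [r0, abs_neg, abs_of_nonneg p2]
  refine (Finset.sum_le_sum fun j _ => hle j).trans (le_of_eq ?_)
  simp only [Finset.sum_add_distrib, Finset.sum_ite_eq, Finset.sum_ite_eq', Finset.mem_univ, if_true,
    Finset.sum_const, Finset.card_univ, Fintype.card_fin, nsmul_eq_mul]
  push_cast
  field_simp
  ring

theorem norm_tiltExpect_pairProd_le (hO : O * O.transpose = 1)
    (hrow : ∀ j, O 0 j = (√(m + 1))⁻¹) (h0 : 0 ≤ a) (h1 : a ≤ 1 / 100)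
    (hs : 2 * (s : ℝ) = (m + 1) * a) (σ τ : Equiv.Perm (Fin (m + 1))) {q : ℝ}
    (hq : q = Real.exp (pseudoVar m a * (m + 1 : ℕ)) / shiftedMean a) :
    ‖tiltExpect (linCoeff m) (two_mul_quadCoeff_lt h0 h1 hs)
        (pairProd O σ τ Finset.univ Finset.univ)‖
      ≤ (∏ p, tiltMass s (quadCoeff m p) (linCoeff m p))
        * (shiftedMean a ^ (m + 1)
          * Real.exp (-(pseudoVar m a * ((m + 1 : ℕ) * ((m + 1 : ℕ) - 1)) / 2))) ^ 2
        * (Real.exp (3 * q ^ 2 * excessVar m a)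
          * ∏ i, (1 + if σ i = τ i then q ^ 2 * circVar m a else 0)) := by
  set Z := ∏ p, tiltMass s (quadCoeff m p) (linCoeff m p) with hZ
  have hZpos : 0 < Z := Finset.prod_pos fun p _ => tiltMass_pos (two_mul_quadCoeff_lt h0 h1 hs p) _
  have hZ0 : (Z : ℂ) ≠ 0 := by exact_mod_cast hZpos.ne'
  have hd := (excessVar_bounds (m := m) h0 h1).1
  have hv : 0 ≤ circVar m a := le_trans (by positivity) (circVar_bounds (m := m) h0 h1).1
  obtain ⟨hμ, hμ1⟩ := shiftedMean_bounds h0 h1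
  -- Dividing by the total mass Z normalises the tilted expectation to satisfy w ∅ ∅ = 1.
  have hw := norm_wick_univ_le (n := m + 1) (ε := pseudoVar m a) (μ := shiftedMean a)
    (w := fun S T => tiltExpect (linCoeff m) (two_mul_quadCoeff_lt h0 h1 hs)
      (pairProd O σ τ S T) / Z)
    (κ := fun i j => (((if σ i = τ j then 1 else 0) * (if i = j then 1 else 0) * circVar m a
          + excessVar m a * (((if σ i = τ j then 1 else 0) + (if i = j then 1 else 0)) / (m + 1)
              - 1 / (m + 1) ^ 2) : ℝ) : ℂ))
    (by
      rw [pairProd, Finset.prod_empty, Finset.prod_empty, one_mul, tiltExpect_one, div_self hZ0])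
    (fun j T hj => by
      rw [tiltExpect_pairProd_empty_insert hO hrow h0 h1 hs σ τ hj, ← Finset.sum_div]
      ring)
    (fun i S T hi => by
      rw [tiltExpect_pairProd_insert_left hO hrow h0 h1 hs σ τ hi, ← Finset.sum_div, add_div,
        Finset.sum_div]
      simp only [mul_div_assoc]
      ring)
    (by linarith) hμ1 (pseudoVar_nonneg h0 h1) (Fintype.card_fin _)
    (by have := pseudoVar_mul_le (m := m) h0 h1; nlinarith)
  rw [← hq, norm_div, Complex.norm_real, Real.norm_of_nonneg hZpos.le, div_le_iff₀ hZpos] at hw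
  refine hw.trans ?_
  rw [mul_comm _ Z, ← mul_assoc]
  refine mul_le_mul_of_nonneg_left ?_ (by positivity)
  -- Uses 1 + x + y ≤ (1 + x)(1 + y) ≤ exp(x)(1 + y), with x the excess part, so that the excess
  -- leaves the product as one exponential.
  have hstep : ∀ i, 1 + q ^ 2 * ∑ j, ‖((((if σ i = τ j then 1 else 0) * (if i = j then 1 else 0)
          * circVar m a
          + excessVar m a * (((if σ i = τ j then 1 else 0) + (if i = j then 1 else 0)) / (m + 1)
              - 1 / (m + 1) ^ 2) : ℝ) : ℂ))‖
      ≤ Real.exp (3 * q ^ 2 * excessVar m a / (m + 1))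
        * (1 + if σ i = τ i then q ^ 2 * circVar m a else 0) := by
    intro i
    have h2 := mul_le_mul_of_nonneg_left (sum_norm_mixed_le h0 h1 σ τ i) (sq_nonneg q)
    have h3 := Real.add_one_le_exp (3 * q ^ 2 * excessVar m a / (m + 1))
    set y := (if σ i = τ i then q ^ 2 * circVar m a else 0) with hy
    have hy0 : 0 ≤ y := by rw [hy]; split_ifs <;> positivity
    have hx0 : 0 ≤ 3 * q ^ 2 * excessVar m a / (m + 1) := by positivity
    have h4 : q ^ 2 * ((if σ i = τ i then circVar m a else 0) + 3 * excessVar m a / (m + 1))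
        = y + 3 * q ^ 2 * excessVar m a / (m + 1) := by
      rw [hy, mul_add, mul_ite, mul_zero]; ring
    rw [h4] at h2
    have h5 := mul_le_mul_of_nonneg_right h3 (show 0 ≤ 1 + y by linarith)
    nlinarith [mul_nonneg hx0 hy0]
  refine (Finset.prod_le_prod (fun i _ => by positivity) fun i _ => hstep i).trans (le_of_eq ?_)
  rw [Finset.prod_mul_distrib, Finset.prod_const, Finset.card_univ, Fintype.card_fin,
    ← Real.exp_nat_mul]
  congr 2
  push_cast
  field_simp

end Covariance

/-! ### The second moment as a tilted expectation -/

section SecondMoment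

variable {m : ℕ} {O : Matrix (Fin (m + 1)) (Fin (m + 1)) ℝ}

theorem evalReal_entry (hO : O * O.transpose = 1) (A : Matrix (Fin (m + 1)) (Fin (m + 1)) ℂ)
    (i j : Fin (m + 1)) :
    evalReal (affineForm 1 (entryCoeff O Complex.I i j)) (realCoord (conjReal O A)) = 1 + A i j := by
  rw [evalReal_affineForm, eq_conjReal_transpose hO A i j, Fintype.sum_prod_type,
    Fintype.sum_prod_type, Finset.sum_comm]
  congr 1
  refine Finset.sum_congr rfl fun l _ => Finset.sum_congr rfl fun k _ => ?_
  rw [Fin.sum_univ_two]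
  have e := Complex.re_add_im (conjReal O A k l)
  simp only [entryCoeff, realCoord, reIm, if_true, one_ne_zero, if_false]
  push_cast
  linear_combination (O k i : ℂ) * O l j * e

theorem evalReal_entry_conj (hO : O * O.transpose = 1)
    (A : Matrix (Fin (m + 1)) (Fin (m + 1)) ℂ) (i j : Fin (m + 1)) :
    evalReal (affineForm 1 (entryCoeff O (-Complex.I) i j)) (realCoord (conjReal O A))
      = (starRingEnd ℂ) (1 + A i j) := by
  rw [← evalReal_entry hO, evalReal_affineForm, evalReal_affineForm, map_add, map_one, map_sum]
  congr 1
  refine Finset.sum_congr rfl fun p _ => ?_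
  rw [map_mul, Complex.conj_ofReal]
  congr 1
  rw [entryCoeff, entryCoeff, map_mul, Complex.conj_ofReal]
  split_ifs <;> simp

/-- The squared modulus of the normalised permanent, in the real coordinates of `O (z W) Oᵀ`. -/
noncomputable def permPoly (O : Matrix (Fin (m + 1)) (Fin (m + 1)) ℝ) :
    MvPolynomial ((Fin (m + 1) × Fin (m + 1)) × Fin 2) ℂ :=
  (((m + 1)! : ℂ)⁻¹ ^ 2) • ∑ σ, ∑ τ, pairProd O σ τ Finset.univ Finset.univ

theorem norm_sq_normalizedPermanent_eq (hO : O * O.transpose = 1)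
    (W : Matrix (Fin (m + 1)) (Fin (m + 1)) ℂ) (z : ℂ) :
    ((‖normalizedPermanent W z‖ ^ 2 : ℝ) : ℂ)
      = evalReal (permPoly O) (realCoord (conjReal O (z • W))) := by
  have h1 : ∀ i j, evalReal (affineForm 1 (entryCoeff O Complex.I i j))
      (realCoord (conjReal O (z • W))) = 1 + z * W i j := fun i j => by
    rw [evalReal_entry hO]; rfl
  have h2 : ∀ i j, evalReal (affineForm 1 (entryCoeff O (-Complex.I) i j))
      (realCoord (conjReal O (z • W))) = (starRingEnd ℂ) (1 + z * W i j) := fun i j => by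
    rw [evalReal_entry_conj hO]; rfl
  rw [Complex.ofReal_pow, ← Complex.mul_conj', normalizedPermanent_eq, map_div₀, map_sum]
  simp only [map_prod, Complex.conj_natCast]
  unfold evalReal at h1 h2 ⊢
  simp only [permPoly, pairProd, MvPolynomial.smul_eval, map_sum, map_mul, map_prod, h1, h2]
  rw [div_mul_div_comm, Finset.sum_mul_sum, div_eq_mul_inv, mul_comm, pow_two, mul_inv]

theorem norm_sq_reweightedPermanent_eq (hO : O * O.transpose = 1)
    (hrow : ∀ j, O 0 j = (√(m + 1))⁻¹) (W : Matrix (Fin (m + 1)) (Fin (m + 1)) ℂ) (z : ℂ) :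
    ((‖reweightedPermanent W z‖ ^ 2 : ℝ) : ℂ)
      = tiltWeight (quadCoeff m) (linCoeff m) (realCoord (conjReal O (z • W)))
        * evalReal (permPoly O) (realCoord (conjReal O (z • W))) := by
  rw [reweightedPermanent, norm_mul, mul_pow, exponent_eq hO hrow, norm_exp_sq_eq_tiltWeight,
    Complex.ofReal_mul, norm_sq_normalizedPermanent_eq hO]

theorem norm_tiltExpect_permPoly_le {a : ℝ} {s : ℝ≥0} (hO : O * O.transpose = 1)
    (hrow : ∀ j, O 0 j = (√(m + 1))⁻¹) (h0 : 0 ≤ a) (h1 : a ≤ 1 / 100)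
    (hs : 2 * (s : ℝ) = (m + 1) * a) :
    ‖tiltExpect (linCoeff m) (two_mul_quadCoeff_lt h0 h1 hs) (permPoly O)‖
      ≤ Real.exp (50 * ((m + 1) * a ^ 3)) := by
  obtain ⟨q, hq⟩ : ∃ q, q = Real.exp (pseudoVar m a * (m + 1 : ℕ)) / shiftedMean a := ⟨_, rfl⟩
  have hv : 0 ≤ circVar m a := le_trans (by positivity) (circVar_bounds (m := m) h0 h1).1
  have ht : 0 ≤ q ^ 2 * circVar m a := by positivity
  set t := q ^ 2 * circVar m a with htdef
  set F : ℝ := (((m + 1)! : ℝ)⁻¹ ^ 2) * ∑ σ : Equiv.Perm (Fin (m + 1)),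
    ∑ τ : Equiv.Perm (Fin (m + 1)), ∏ i, (1 + if σ i = τ i then t else 0) with hF
  have hf0 : ((m + 1)! : ℝ) ≠ 0 := by exact_mod_cast Nat.factorial_ne_zero _
  have hFeq : F = ((m + 1)! : ℝ)⁻¹ * ∑ ρ : Equiv.Perm (Fin (m + 1)),
      ∏ i, (1 + if ρ i = i then t else 0) := by
    rw [hF, sum_perm_perm_prod_eq]; field_simp
  have hFle : F ≤ Real.exp t := by
    rw [hFeq, inv_mul_le_iff₀ (by positivity)]
    exact sum_perm_prod_fixed_le t ht
  -- With a single permutation, which fixes its one point, the average is exactly 1 + t.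
  have hF0 : m = 0 → F ≤ 1 + t := by
    rintro rfl
    rw [hFeq]
    simp
  have hFnn : 0 ≤ F := by
    rw [hFeq]
    refine mul_nonneg (by positivity) (Finset.sum_nonneg fun ρ _ => Finset.prod_nonneg fun i _ => ?_)
    split_ifs <;> positivity
  refine le_trans ?_ (second_moment_estimate h0 h1 hq hFle hF0)
  set K := (shiftedMean a ^ (m + 1)
          * Real.exp (-(pseudoVar m a * ((m + 1 : ℕ) * ((m + 1 : ℕ) - 1)) / 2))) ^ 2 with hK
  have hE := Real.exp_pos (3 * q ^ 2 * excessVar m a)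
  calc ‖tiltExpect (linCoeff m) (two_mul_quadCoeff_lt h0 h1 hs) (permPoly O)‖
      ≤ (((m + 1)! : ℝ)⁻¹ ^ 2) * ∑ σ : Equiv.Perm (Fin (m + 1)), ∑ τ : Equiv.Perm (Fin (m + 1)),
        ((∏ p, tiltMass s (quadCoeff m p) (linCoeff m p)) * K
          * (Real.exp (3 * q ^ 2 * excessVar m a)
            * ∏ i, (1 + if σ i = τ i then t else 0))) := by
        rw [permPoly, map_smul, smul_eq_mul, norm_mul, norm_pow, norm_inv, Complex.norm_natCast,
          map_sum]
        refine mul_le_mul_of_nonneg_left ?_ (by positivity)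
        refine (norm_sum_le _ _).trans (Finset.sum_le_sum fun σ _ => ?_)
        rw [map_sum]
        refine (norm_sum_le _ _).trans (Finset.sum_le_sum fun τ _ => ?_)
        exact norm_tiltExpect_pairProd_le hO hrow h0 h1 hs σ τ hq
    _ = (∏ p, tiltMass s (quadCoeff m p) (linCoeff m p)) * K
          * (Real.exp (3 * q ^ 2 * excessVar m a) * F) := by
        simp only [← Finset.mul_sum]
        rw [hF]
        ring
    _ ≤ _ := by
        refine mul_le_mul_of_nonneg_right (mul_le_mul_of_nonneg_right
          (prod_tiltMass_le h0 h1 hs) (sq_nonneg _)) (by positivity)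

end SecondMoment

/-! ### Positivity of the second moment -/

section Positivity

theorem integral_id_complexGaussian (ν : ℝ≥0) : ∫ w, w ∂complexGaussian ν = 0 ∧
    Integrable (fun w : ℂ => w) (complexGaussian ν) := by
  have hl : ∀ c, HasLaw (fun w => reIm c w) (gaussianReal 0 (ν / 2)) (complexGaussian ν) :=
    fun c => HasLaw.pi_eval (hasLaw_reIm_complexGaussian ν) c
  have hi : ∀ c, Integrable (fun w => reIm c w) (complexGaussian ν) := fun c =>
    ((hl c).hasGaussianLaw.memLp_two).integrable one_le_two
  have hz : ∀ c, ∫ w, ((reIm c w : ℝ) : ℂ) ∂complexGaussian ν = 0 := fun c =>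
    (integral_ofReal (𝕜 := ℂ) (f := fun w => reIm c w)).trans (by
      rw [(hl c).integral_eq, integral_id_gaussianReal]; simp)
  have e : (fun w : ℂ => w) = fun w => ((reIm 0 w : ℝ) : ℂ) + ((reIm 1 w : ℝ) : ℂ) * Complex.I := by
    ext w
    simp [reIm]
  rw [e]
  have h0 : Integrable (fun w => ((reIm 0 w : ℝ) : ℂ)) (complexGaussian ν) := (hi 0).ofReal
  have h1 : Integrable (fun w => ((reIm 1 w : ℝ) : ℂ) * Complex.I) (complexGaussian ν) :=
    (hi 1).ofReal.mul_const _
  refine ⟨?_, h0.add h1⟩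
  rw [integral_add h0 h1, integral_mul_const, hz, hz]
  simp

variable {n : ℕ} {ν : ℝ≥0} {Ω : Type*} [MeasurableSpace Ω] {P : Measure Ω}
  [IsProbabilityMeasure P] {W : Ω → Matrix (Fin n) (Fin n) ℂ}

/-- The factors along one permutation lie in distinct columns, hence are independent, and each has
mean 1. -/
theorem integral_normalizedPermanent (hW : IsComplexGaussianMatrix P ν W) (z : ℂ) :
    ∫ ω, normalizedPermanent (W ω) z ∂P = 1 := by
  have hm : ∀ i j, AEMeasurable (fun ω => W ω i j) P := fun i j => (hW.hasLaw i j).aemeasurable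
  have hI : ∀ i j, Integrable (fun ω => 1 + z * W ω i j) P := fun i j => by
    have h := (integral_id_complexGaussian ν).2
    rw [← (hW.hasLaw i j).map_eq] at h
    exact (integrable_const 1).add ((h.comp_aemeasurable (hm i j)).const_mul z)
  have h1 : ∀ i j, ∫ ω, (1 + z * W ω i j) ∂P = 1 := fun i j => by
    have h := (integral_id_complexGaussian ν).2
    rw [← (hW.hasLaw i j).map_eq] at h
    have h' : Integrable (fun ω => W ω i j) P := h.comp_aemeasurable (hm i j)
    rw [integral_add (integrable_const 1) (h'.const_mul z), integral_const_mul,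
      (hW.hasLaw i j).integral_eq, (integral_id_complexGaussian ν).1]
    simp
  have hind : ∀ σ : Equiv.Perm (Fin n), iIndepFun (fun i ω => W ω (σ i) i) P := fun σ =>
    hW.indep.precomp (g := fun i => (σ i, i)) fun i j h => (Prod.ext_iff.1 h).2
  have hind' : ∀ σ : Equiv.Perm (Fin n), iIndepFun (fun i ω => 1 + z * W ω (σ i) i) P := fun σ =>
    (hind σ).comp (fun _ w => 1 + z * w) fun _ => by fun_prop
  have hprod : ∀ σ : Equiv.Perm (Fin n), ∫ ω, ∏ i, (1 + z * W ω (σ i) i) ∂P = 1 := fun σ => by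
    rw [(hind σ).integral_fun_prod_comp (f := fun _ w => 1 + z * w) (fun i => hm _ _)
      (fun i => (by fun_prop : Continuous fun w : ℂ => 1 + z * w).aestronglyMeasurable)]
    exact Finset.prod_eq_one fun i _ => h1 _ _
  have hint : ∀ σ : Equiv.Perm (Fin n), Integrable (fun ω => ∏ i, (1 + z * W ω (σ i) i)) P := by
    intro σ
    -- A non-integrable function has integral 0 by convention, so the value 1 already forces
    -- integrability.
    by_contra h
    have := integral_undef h
    rw [hprod σ] at this
    exact one_ne_zero this
  simp_rw [normalizedPermanent_eq]
  rw [integral_div, integral_finsetSum _ fun σ _ => hint σ, Finset.sum_congr rfl fun σ _ => hprod σ]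
  simp [Fintype.card_perm, Nat.factorial_ne_zero]

/-- If the second moment vanished, so would the permanent almost surely, the exponential factor
being nonzero; this contradicts its mean 1. -/
theorem integral_norm_sq_reweightedPermanent_pos (hW : IsComplexGaussianMatrix P ν W) (z : ℂ)
    (hint : Integrable (fun ω => ‖reweightedPermanent (W ω) z‖ ^ 2) P) :
    0 < ∫ ω, ‖reweightedPermanent (W ω) z‖ ^ 2 ∂P := by
  refine lt_of_le_of_ne (integral_nonneg fun ω => sq_nonneg _) fun h => ?_
  have h0 := (integral_eq_zero_iff_of_nonneg (fun ω => sq_nonneg _) hint).1 h.symm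
  have h1 : (fun ω => normalizedPermanent (W ω) z) =ᵐ[P] fun _ => 0 := by
    filter_upwards [h0] with ω hω
    have : reweightedPermanent (W ω) z = 0 := by simpa using hω
    exact (mul_eq_zero.1 this).resolve_left (Complex.exp_ne_zero _)
  have h2 := integral_normalizedPermanent hW z
  rw [integral_congr_ae h1] at h2
  simp at h2

end Positivity

/-! ### Conclusion -/

theorem mainTheorem2 :
    ∃ c C : ℝ, 0 < c ∧ 0 < C ∧
      ∀ (n : ℕ) (ν : ℝ≥0) (z : ℂ), 1 ≤ n → (ν : ℝ) * ‖z‖ ^ 2 / n ≤ c →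
      ∀ {Ω : Type*} [MeasurableSpace Ω] (P : Measure Ω) [IsProbabilityMeasure P]
        (W : Ω → Matrix (Fin n) (Fin n) ℂ), IsComplexGaussianMatrix P ν W →
        Integrable (fun ω => ‖reweightedPermanent (W ω) z‖ ^ 2) P ∧
        0 < ∫ ω, ‖reweightedPermanent (W ω) z‖ ^ 2 ∂P ∧
        Real.log (∫ ω, ‖reweightedPermanent (W ω) z‖ ^ 2 ∂P)
          ≤ C * ((ν : ℝ) ^ 3 * ‖z‖ ^ 6 / (n : ℝ) ^ 2) := by
  refine ⟨1 / 100, 50, by norm_num, by norm_num, ?_⟩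
  intro n ν z hn hc Ω _ P _ W hW
  obtain ⟨m, rfl⟩ : ∃ m, n = m + 1 := ⟨n - 1, by omega⟩
  obtain ⟨O, hO, hrow⟩ := exists_orthogonal_const_row m
  set a : ℝ := (ν : ℝ) * ‖z‖ ^ 2 / (m + 1 : ℕ) with ha
  have h0 : 0 ≤ a := by positivity
  have hn0 : ((m : ℝ) + 1) ≠ 0 := by positivity
  -- Each real coordinate of zW has variance s = |z|²ν/2, so 2s = na; with a ≤ 1/100 every tilt is
  -- then admissible.
  have hs : 2 * ((‖z‖₊ ^ 2 * (ν / 2) : ℝ≥0) : ℝ) = (m + 1) * a := by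
    rw [ha]
    push_cast
    field_simp
  have hlaw : HasLaw (fun ω => realCoord (conjReal O (z • W ω)))
      (Measure.pi fun _ => gaussianReal 0 (‖z‖₊ ^ 2 * (ν / 2))) P := hasLaw_realCoord_conj hW z hO
  have hI := integrable_tiltWeight_mul (linCoeff m) (two_mul_quadCoeff_lt h0 hc hs) (permPoly O)
  have hpt : ∀ ω, ((‖reweightedPermanent (W ω) z‖ ^ 2 : ℝ) : ℂ)
      = tiltWeight (quadCoeff m) (linCoeff m) (realCoord (conjReal O (z • W ω)))
        * evalReal (permPoly O) (realCoord (conjReal O (z • W ω))) :=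
    fun ω => norm_sq_reweightedPermanent_eq hO hrow (W ω) z
  have hint : Integrable (fun ω => ‖reweightedPermanent (W ω) z‖ ^ 2) P := by
    have hI' := hI
    rw [← hlaw.map_eq] at hI'
    have h2 := (hI'.comp_aemeasurable hlaw.aemeasurable).re
    refine h2.congr (Filter.Eventually.of_forall fun ω => ?_)
    simp only [Function.comp_apply]
    rw [← hpt]
    exact Complex.ofReal_re _
  have hpos := integral_norm_sq_reweightedPermanent_pos hW z hint
  have hE : ((∫ ω, ‖reweightedPermanent (W ω) z‖ ^ 2 ∂P : ℝ) : ℂ)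
      = tiltExpect (linCoeff m) (two_mul_quadCoeff_lt h0 hc hs) (permPoly O) := by
    rw [tiltExpect_apply, ← hlaw.integral_comp hI.aestronglyMeasurable]
    exact (integral_ofReal (𝕜 := ℂ)).symm.trans <| integral_congr_ae (Filter.Eventually.of_forall fun ω => hpt ω)
  refine ⟨hint, hpos, ?_⟩
  have hb := norm_tiltExpect_permPoly_le hO hrow h0 hc hs
  rw [← hE, Complex.norm_real, Real.norm_of_nonneg hpos.le] at hb
  refine (Real.log_le_iff_le_exp hpos).2 (hb.trans (Real.exp_le_exp.2 (le_of_eq ?_)))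
  rw [ha]
  push_cast
  field_simp
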